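/- Let $0<b<R$ and $\Gamma>0$. For $\tau\in\mathbb R$ let $z(\tau)=b$ if $\tau\in[n,n+\tfrac12)$ and $z(\tau)=-b$ if $\tau\in[n+\tfrac12,n+1)$, $n\in\mathbb Z$, and on $\mathcal D=\mathbb C\setminus\{\pm b,\pm R^2/b\}$ let $$\hat H(\zeta)=\int_0^1\frac{\Gamma}{2\pi}\ln\left|\frac{\zeta-z(\tau)}{z(\tau)\zeta-R^2}\right|d\tau=\frac{\Gamma}{4\pi}\ln\left|\frac{\zeta^2-b^2}{b^2\zeta^2-R^4}\right|$$ be the averaged Hamiltonian. With $\zeta=x+iy$, the averaged system with parameter $T>0$ is $\dot\eta=T\,J\nabla\hat H(\eta)$, that is $\dot x=-T\,\partial_y\hat H$, $\dot y=T\,\partial_x\hat H$; its time-$1$ (Poincaré) map is denoted $\hat M_1^T$. Put $$I(E)=\frac{1}{2\pi(1-E^2b^4)}\int_0^{\pi/2}\sqrt{4b^4(1-E^2R^4)^2\cos^2(2\psi)+4(E^2b^4-1)(b^4-E^2R^8)}\;d\psi .$$ (1) The function $I$ is $C^\infty$ near every point of $(b^2/R^4,1/R^2]$. The set $$\mathcal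 S=\Big\{E\in\Big(\frac{b^2}{R^4},\frac1{R^2}\Big]: I'(E)\neq0\ \text{ and }\ E\,I''(E)+I'(E)\neq 0\Big\}$$ contains $1/R^2$, and the connected component $\mathcal E$ of $\mathcal S$ containing $1/R^2$ is a nondegenerate interval $(E_*,1/R^2]$ with $b^2/R^4\le E_*<1/R^2$. (2) Let $E_0\in(\inf\mathcal E,1/R^2)$ and $$A=\Big\{\zeta\in\mathcal D:\ |\zeta|\le R,\ \frac{\Gamma}{4\pi}\ln E_0\le\hat H(\zeta)\le\frac{\Gamma}{4\pi}\ln\frac1{R^2}\Big\}.$$ Put $I_0=I(E_0)$. Then $0<I_0<R^2/2$ and $I$ is a bijection from $[E_0,1/R^2]$ onto $[I_0,R^2/2]$. The function $\hat H(J):=\frac{\Gamma}{4\pi}\ln I^{-1}(J)$ is $C^\infty$ on $[I_0,R^2/2]$, with $\hat H''(J)<0$ for all $J\in[I_0,R^2/2]$. There are smooth canonical action-angle coordinates $(\theta,J)\in(\mathbb R/2\pi\mathbb Z)\times[I_0,R^2/2]$ on $A$ (with $dJ\wedge d\theta=dx\wedge dy$), independent of $T$, in which the averaged Hamiltonian is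 $\hat H(J)$. For every $T>0$ the map $\hat M_1^T$ is well defined on $A$, and in these coordinates it is the small twist map $$(\theta,J)\longmapsto(\theta+T\,\hat H'(J),\,J),$$ where $\hat H''\ne0$ on $[I_0,R^2/2]$. -/

import Mathlib

open scoped ContDiff

noncomputable section

namespace Stirring

/-- The stirring protocol in the rescaled time `τ`, of period `1`: the agitator sits at `b` on
`[n, n + 1/2)` and at `-b` on `[n + 1/2, n + 1)`. -/
def protocol (b τ : ℝ) : ℝ := if Int.fract τ < 1 / 2 then b else -b

/-- Hamilton function of an agitator of strength `Γ` located at the real point `z`, in the disk of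
radius `R` (it is meaningful for `ζ ≠ z` and `z * ζ ≠ R ^ 2`). -/
def vortexHamiltonian (R Γ z : ℝ) (ζ : ℂ) : ℝ :=
  Γ / (2 * Real.pi) * Real.log ‖(ζ - (z : ℂ)) / ((z : ℂ) * ζ - (R : ℂ) ^ 2)‖

/-- The averaged Hamiltonian: the mean over one period of the rescaled time. -/
def avgHamiltonian (b R Γ : ℝ) (ζ : ℂ) : ℝ :=
  ∫ τ in (0 : ℝ)..1, vortexHamiltonian R Γ (protocol b τ) ζ

/-- The plane without the singularities `±b`, `±R²/b` of the averaged Hamiltonian. -/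
def domain (b R : ℝ) : Set ℂ :=
  {ζ | ζ ≠ (b : ℂ) ∧ ζ ≠ -(b : ℂ) ∧ ζ ≠ (R : ℂ) ^ 2 / (b : ℂ) ∧ ζ ≠ -((R : ℂ) ^ 2 / (b : ℂ))}

theorem avgHamiltonian_eq_mean (b R Γ : ℝ) (ζ : ℂ) :
    avgHamiltonian b R Γ ζ =
      (vortexHamiltonian R Γ b ζ + vortexHamiltonian R Γ (-b) ζ) / 2 := by
  have key : ∀ (u v : ℝ) (z : ℝ), 0 ≤ u → u ≤ v → v ≤ 1 →
      (∀ τ ∈ Set.Ioo u v, protocol b τ = z) →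
      IntervalIntegrable (fun τ => vortexHamiltonian R Γ (protocol b τ) ζ)
        MeasureTheory.volume u v ∧
      ∫ τ in u..v, vortexHamiltonian R Γ (protocol b τ) ζ
        = (v - u) * vortexHamiltonian R Γ z ζ := by
    intro u v z _ huv _ h
    constructor
    · rw [intervalIntegrable_iff_integrableOn_Ioo_of_le huv]
      refine MeasureTheory.IntegrableOn.congr_fun
        (f := fun _ => vortexHamiltonian R Γ z ζ) ?_ ?_ measurableSet_Ioo
      · exact MeasureTheory.integrableOn_const (by simp)
      · intro τ hτ
        simp only [h τ hτ]
    · rw [intervalIntegral.integral_of_le huv, MeasureTheory.integral_Ioc_eq_integral_Ioo,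
        MeasureTheory.setIntegral_congr_fun (g := fun _ => vortexHamiltonian R Γ z ζ)
          measurableSet_Ioo (fun τ hτ => by simp only [h τ hτ]),
        MeasureTheory.setIntegral_const]
      simp [MeasureTheory.measureReal_def, huv]
  have h1 := key 0 (1 / 2) b (by norm_num) (by norm_num) (by norm_num) (by
    intro τ hτ
    have : Int.fract τ = τ := Int.fract_eq_self.2 ⟨hτ.1.le, by linarith [hτ.2]⟩
    simp only [protocol, this, if_pos hτ.2])
  have h2 := key (1 / 2) 1 (-b) (by norm_num) (by norm_num) (by norm_num) (by
    intro τ hτ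
    have : Int.fract τ = τ := Int.fract_eq_self.2 ⟨by linarith [hτ.1], hτ.2⟩
    simp only [protocol, this, if_neg (not_lt.2 hτ.1.le)])
  rw [avgHamiltonian, ← intervalIntegral.integral_add_adjacent_intervals h1.1 h2.1, h1.2, h2.2]
  ring

/-- Closed form of the averaged Hamiltonian: two fixed vortices at `b` and `-b`. -/
theorem avgHamiltonian_eq_log (b R Γ : ℝ) (hb : b ≠ 0) (ζ : ℂ) (hζ : ζ ∈ domain b R) :
    avgHamiltonian b R Γ ζ = Γ / (4 * Real.pi) *
      Real.log ‖(ζ ^ 2 - (b : ℂ) ^ 2) / ((b : ℂ) ^ 2 * ζ ^ 2 - (R : ℂ) ^ 4)‖ := by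
  obtain ⟨h1, h2, h3, h4⟩ := hζ
  have hb' : (b : ℂ) ≠ 0 := by exact_mod_cast hb
  have e1 : ζ - (b : ℂ) ≠ 0 := sub_ne_zero.2 h1
  have e2 : ζ - ((-b : ℝ) : ℂ) ≠ 0 := by
    rw [sub_ne_zero]; push_cast; exact h2
  have e3 : (b : ℂ) * ζ - (R : ℂ) ^ 2 ≠ 0 := by
    intro h
    apply h3
    rw [eq_div_iff hb']
    linear_combination h
  have e4 : ((-b : ℝ) : ℂ) * ζ - (R : ℂ) ^ 2 ≠ 0 := by
    intro h
    apply h4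
    push_cast at h
    rw [← neg_div, eq_div_iff hb']
    linear_combination -h
  have n1 := norm_ne_zero_iff.2 (div_ne_zero e1 e3)
  have n2 := norm_ne_zero_iff.2 (div_ne_zero e2 e4)
  have e5 : ζ ^ 2 - (b : ℂ) ^ 2 = (ζ - (b : ℂ)) * (ζ - ((-b : ℝ) : ℂ)) := by
    push_cast; ring
  have e6 : (b : ℂ) ^ 2 * ζ ^ 2 - (R : ℂ) ^ 4 =
      -(((b : ℂ) * ζ - (R : ℂ) ^ 2) * (((-b : ℝ) : ℂ) * ζ - (R : ℂ) ^ 2)) := by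
    push_cast; ring
  rw [avgHamiltonian_eq_mean, vortexHamiltonian, vortexHamiltonian, e5, e6, div_neg, norm_neg,
    mul_div_mul_comm, norm_mul, Real.log_mul n1 n2]
  field_simp
  ring

/-- `J ∇Ĥ`, that is `ẋ = -∂Ĥ/∂y`, `ẏ = ∂Ĥ/∂x`. This is the orientation for which the stirring
system `d(conj ζ)/dt = Γ/(2πi) * (z² - R²)/((ζ - z)(z ζ - R²))` is Hamiltonian. -/
def hamiltonianField (H : ℂ → ℝ) (ζ : ℂ) : ℂ :=
  ⟨-(fderiv ℝ H ζ Complex.I), fderiv ℝ H ζ 1⟩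

/-- `η` is, on the time interval `[0, 1]`, a solution of the averaged system
`η̇ = T J ∇Ĥ(η)`. -/
def IsAvgTrajectory (b R Γ T : ℝ) (η : ℝ → ℂ) : Prop :=
  ∀ t ∈ Set.Icc (0 : ℝ) 1, η t ∈ domain b R ∧
    HasDerivWithinAt η ((T : ℂ) * hamiltonianField (avgHamiltonian b R Γ) (η t))
      (Set.Icc 0 1) t

/-- `M` is the time-`1` (Poincaré) map of the averaged system on the set `A`: from every point of
`A` there starts a solution defined on `[0, 1]`, and every such solution ends at the value of `M`. -/
def IsAvgPoincareMap (b R Γ T : ℝ) (A : Set ℂ) (M : ℂ → ℂ) : Prop :=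
  ∀ ζ ∈ A, (∃ η, IsAvgTrajectory b R Γ T η ∧ η 0 = ζ) ∧
    ∀ η, IsAvgTrajectory b R Γ T η → η 0 = ζ → η 1 = M ζ

/-- The action integral `I(E)`. -/
def action (b R E : ℝ) : ℝ :=
  1 / (1 - E ^ 2 * b ^ 4) / (2 * Real.pi) *
    ∫ ψ in (0 : ℝ)..(Real.pi / 2),
      Real.sqrt (4 * b ^ 4 * (1 - E ^ 2 * R ^ 4) ^ 2 * Real.cos (2 * ψ) ^ 2
        + 4 * (E ^ 2 * b ^ 4 - 1) * (b ^ 4 - E ^ 2 * R ^ 8))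

/-- The energies in `(b²/R⁴, 1/R²]` with `I'(E) ≠ 0` and `E I''(E) + I'(E) ≠ 0`. -/
def regularEnergies (b R : ℝ) : Set ℝ :=
  {E | E ∈ Set.Ioc (b ^ 2 / R ^ 4) (1 / R ^ 2) ∧ deriv (action b R) E ≠ 0 ∧
    E * deriv (deriv (action b R)) E + deriv (action b R) E ≠ 0}

/-- The connected component of the boundary energy `1/R²` in the set of regular energies. -/
def twistEnergies (b R : ℝ) : Set ℝ :=
  connectedComponentIn (regularEnergies b R) (1 / R ^ 2)

/-- The annulus between the level `E₀` and the boundary circle. -/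
def annulus (b R Γ E₀ : ℝ) : Set ℂ :=
  {ζ | ζ ∈ domain b R ∧ ‖ζ‖ ≤ R ∧
    Γ / (4 * Real.pi) * Real.log E₀ ≤ avgHamiltonian b R Γ ζ ∧
    avgHamiltonian b R Γ ζ ≤ Γ / (4 * Real.pi) * Real.log (1 / R ^ 2)}

/-- The energy as a function of the action, `Ĥ(J) = (Γ/4π) ln E` where `E` is the point of
`[E₀, 1/R²]` with `I(E) = J`. -/
def energyOfAction (b R Γ E₀ J : ℝ) : ℝ :=
  Γ / (4 * Real.pi) *
    Real.log (Function.invFunOn (action b R) (Set.Icc E₀ (1 / R ^ 2)) J)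

/-- `(θ, J) ↦ Φ θ J`, with `θ` modulo `2π` and `J ∈ [I₀, I₁]`, are smooth action-angle coordinates
on `A` for the Hamiltonian `H`, whose expression in the action is `h`. In the orientation of
`hamiltonianField`, canonical means `dJ ∧ dθ = dx ∧ dy`. -/
structure IsActionAngle (H : ℂ → ℝ) (A : Set ℂ) (I₀ I₁ : ℝ) (h : ℝ → ℝ) (Φ : ℝ → ℝ → ℂ) :
    Prop where
  smooth : ContDiffOn ℝ ∞ (fun p : ℝ × ℝ => Φ p.1 p.2) (Set.univ ×ˢ Set.Icc I₀ I₁)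
  image_eq : (fun p : ℝ × ℝ => Φ p.1 p.2) '' (Set.univ ×ˢ Set.Icc I₀ I₁) = A
  eq_iff : ∀ θ θ' : ℝ, ∀ J ∈ Set.Icc I₀ I₁, ∀ J' ∈ Set.Icc I₀ I₁,
    (Φ θ J = Φ θ' J' ↔ J = J' ∧ ∃ k : ℤ, θ' = θ + 2 * Real.pi * k)
  symplectic : ∀ θ : ℝ, ∀ J ∈ Set.Icc I₀ I₁,
    ((starRingEnd ℂ) (derivWithin (fun j => Φ θ j) (Set.Icc I₀ I₁) J)
      * deriv (fun s => Φ s J) θ).im = 1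
  energy : ∀ θ : ℝ, ∀ J ∈ Set.Icc I₀ I₁, H (Φ θ J) = h J

/-- In the coordinates `Φ` on the annulus `I₀ ≤ J ≤ I₁`, the map `M` is the small twist map
`(θ, J) ↦ (θ + T α(J), J)`, with `α' ≠ 0` on `[I₀, I₁]`. -/
structure IsSmallTwistMap (T I₀ I₁ : ℝ) (α : ℝ → ℝ) (Φ : ℝ → ℝ → ℂ) (M : ℂ → ℂ) : Prop where
  pos : 0 < I₀
  lt : I₀ < I₁
  smooth : ContDiffOn ℝ ∞ α (Set.Icc I₀ I₁)
  twist : ∀ J ∈ Set.Icc I₀ I₁, derivWithin α (Set.Icc I₀ I₁) J ≠ 0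
  map_eq : ∀ θ : ℝ, ∀ J ∈ Set.Icc I₀ I₁, M (Φ θ J) = Φ (θ + T * α J) J

end Stirring

end

noncomputable section

namespace Stirring

open Set Filter Topology MeasureTheory

/-! On the level of energy `(Γ/4π) ln E` the squared radius `ρ` in the direction `ψ` solves a
quadratic equation whose coefficients depend on `c = cos 2ψ` and on `m = (1 - E²R⁴)/(1 - E²b⁴)`. For
`b²/R⁴ < E < 1/b²` the product of its roots is negative, so there is exactly one positive root and
the level is a closed curve, star-shaped about `0`. This open interval contains `1/R²`, where `m =
0` and the curve is the circle of radius `R`; hence smoothness up to the end points is obtained from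
neighbourhoods. Since `ρ` increases with `E` (`radiusSq_lt`, `radiusSqDeriv_pos`), the pair `(ψ, E)`
gives coordinates around the origin.

The action is the enclosed area over `2π`: the part of `ρ` odd in `c` averages out and leaves the
square root `W` of the discriminant. As `W' > 0`, also `I' > 0`, and a regular energy is one with
`(E I')' ≠ 0`. Since `Ĥ'(J) = Γ/(4π E I'(E))`, the sign of `Ĥ''` is opposite to that of `(E I')'`.
The latter is positive at `1/R²` by an explicit computation (`twist_boundary_pos`) and cannot change
sign on a connected set of regular energies (`twist_pos`).

The angle is `θ = ∂_E (sector area) / I'(E)`. It gains `2π` per turn (`angle_add`), and `dx ∧ dy = ½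
ρ_E dE ∧ dψ = dJ ∧ dθ` (`area_levelPoint`). The averaged field is the multiple of `∂_ψ` that equals
`Ĥ'(J) ∂_θ` (`hamiltonianField_levelPoint`), so the motion is a uniform rotation in `θ`; uniqueness
of solutions identifies its time-1 value with the Poincaré map. -/

theorem isOpen_prod_univ {X : Type*} [TopologicalSpace X] {U : Set X} (hU : IsOpen U) :
    IsOpen (U ×ˢ (univ : Set ℝ)) :=
  hU.prod isOpen_univ

theorem continuous_slice {X F : Type*} [TopologicalSpace X] [TopologicalSpace F] {U : Set X}
    {f : X × ℝ → F} (hf : ContinuousOn f (U ×ˢ univ)) {x : X} (hx : x ∈ U) :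
    Continuous fun t => f (x, t) := by
  rw [← continuousOn_univ]
  exact hf.comp (by fun_prop) (fun t _ => ⟨hx, mem_univ _⟩)

/-! ### Smooth dependence of integrals on a parameter. -/

section ParametricIntegral

variable {X F : Type} [NormedAddCommGroup X] [NormedSpace ℝ X]
  [NormedAddCommGroup F] [NormedSpace ℝ F]

/-- Differentiation under the integral sign for a `C¹` integrand. -/
theorem hasFDerivAt_intervalIntegral_param {U : Set X} (hU : IsOpen U) {f : X × ℝ → F}
    (hf : ContDiffOn ℝ 1 f (U ×ˢ univ)) (a b : ℝ) {x : X} (hx : x ∈ U) :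
    HasFDerivAt (fun y => ∫ t in a..b, f (y, t))
      (∫ t in a..b, (fderiv ℝ f (x, t)).comp (ContinuousLinearMap.inl ℝ X ℝ)) x := by
  have hO := isOpen_prod_univ hU
  have hd : ContinuousOn (fun p => (fderiv ℝ f p).comp (ContinuousLinearMap.inl ℝ X ℝ))
      (U ×ˢ univ) := (hf.continuousOn_fderiv_of_isOpen hO le_rfl).clm_comp continuousOn_const
  have hdx := continuous_slice hd hx
  obtain ⟨C, hC⟩ := (isCompact_uIcc (a := a) (b := b)).exists_bound_of_continuousOn
    hdx.continuousOn
  -- The dominating function is a constant: by compactness of the interval and the tube lemma, the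
  -- bound `C + 1` on the derivative persists for all parameters near `x`, uniformly in `t`.
  have hO' : IsOpen ((U ×ˢ univ) ∩
      (fun p => ‖(fderiv ℝ f p).comp (ContinuousLinearMap.inl ℝ X ℝ)‖) ⁻¹' Iio (C + 1)) :=
    hd.norm.isOpen_inter_preimage hO isOpen_Iio
  obtain ⟨u, v, hu, -, hxu, hv, huv⟩ := generalized_tube_lemma (s := {x}) isCompact_singleton
    (t := uIcc a b) isCompact_uIcc hO' (by
      rintro ⟨y, t⟩ ⟨rfl, ht⟩
      exact ⟨⟨hx, mem_univ _⟩, lt_of_le_of_lt (hC t ht) (lt_add_one C)⟩)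
  have hu' : u ∩ U ∈ 𝓝 x := (hu.inter hU).mem_nhds ⟨hxu rfl, hx⟩
  refine intervalIntegral.hasFDerivAt_integral_of_dominated_of_fderiv_le (μ := volume)
    (F := fun y t => f (y, t))
    (F' := fun y t => (fderiv ℝ f (y, t)).comp (ContinuousLinearMap.inl ℝ X ℝ))
    (bound := fun _ => C + 1) hu' ?_ ?_ ?_ ?_ ?_ ?_
  · filter_upwards [hu'] with y hy
    exact (continuous_slice hf.continuousOn hy.2).aestronglyMeasurable
  · exact (continuous_slice hf.continuousOn hx).intervalIntegrable _ _
  · exact hdx.aestronglyMeasurable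
  · refine ae_of_all _ fun t ht y hy => ?_
    exact le_of_lt (huv (show (y, t) ∈ u ×ˢ v from ⟨hy.1, hv (uIoc_subset_uIcc ht)⟩)).2
  · exact intervalIntegrable_const
  · refine ae_of_all _ fun t _ y hy => ?_
    have h1 : HasFDerivAt f (fderiv ℝ f (y, t)) (y, t) :=
      ((hf.differentiableOn one_ne_zero).differentiableAt
        (hO.mem_nhds ⟨hy.2, mem_univ _⟩)).hasFDerivAt
    have h2 : HasFDerivAt (fun z : X => (z, t)) (ContinuousLinearMap.inl ℝ X ℝ) y :=
      hasFDerivAt_prodMk_left y t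
    exact h1.comp y h2

/-- Each differentiation replaces `F` by `X →L[ℝ] F`, so the induction must quantify over `F`;
keeping `X` and `F` in `Type` keeps the new target in the same universe. -/
theorem contDiffOn_intervalIntegral_param_nat (n : ℕ) :
    ∀ {F : Type} [NormedAddCommGroup F] [NormedSpace ℝ F] {U : Set X} (_ : IsOpen U)
      {f : X × ℝ → F} (_ : ContDiffOn ℝ ∞ f (U ×ˢ univ)) (a b : ℝ),
      ContDiffOn ℝ n (fun y => ∫ t in a..b, f (y, t)) U := by
  induction n with
  | zero =>
    intro F _ _ U hU f hf a b
    rw [Nat.cast_zero, contDiffOn_zero]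
    exact fun x hx => (hasFDerivAt_intervalIntegral_param hU (hf.of_le (by simp)) a b
      hx).continuousAt.continuousWithinAt
  | succ n ih =>
    intro F _ _ U hU f hf a b
    have hd := fun x hx => hasFDerivAt_intervalIntegral_param hU (hf.of_le (by simp)) a b
      (x := x) hx
    rw [Nat.cast_succ, contDiffOn_succ_iff_fderiv_of_isOpen hU]
    refine ⟨fun x hx => (hd x hx).differentiableAt.differentiableWithinAt, by simp, ?_⟩
    refine (ih hU (f := fun p => (fderiv ℝ f p).comp (ContinuousLinearMap.inl ℝ X ℝ))
      ?_ a b).congr fun x hx => (hd x hx).fderiv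
    exact (hf.fderiv_of_isOpen (isOpen_prod_univ hU) (by simp)).clm_comp contDiffOn_const

/-- The integral of a smooth function depends smoothly on the parameter. -/
theorem contDiffOn_intervalIntegral_param {U : Set X} (hU : IsOpen U) {f : X × ℝ → F}
    (hf : ContDiffOn ℝ ∞ f (U ×ˢ univ)) (a b : ℝ) :
    ContDiffOn ℝ ∞ (fun y => ∫ t in a..b, f (y, t)) U :=
  contDiffOn_infty.2 fun n => contDiffOn_intervalIntegral_param_nat (F := F) n hU hf a b

theorem hasDerivAt_intervalIntegral_param {U : Set ℝ} (hU : IsOpen U) {f f' : ℝ → ℝ → ℝ}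
    (hf : ContDiffOn ℝ 1 (fun p : ℝ × ℝ => f p.1 p.2) (U ×ˢ univ)) (a b : ℝ) {x : ℝ}
    (hx : x ∈ U) (hf' : ∀ t, HasDerivAt (fun y => f y t) (f' x t) x) :
    HasDerivAt (fun y => ∫ t in a..b, f y t) (∫ t in a..b, f' x t) x := by
  have hO := isOpen_prod_univ hU
  have h := (hasFDerivAt_intervalIntegral_param hU hf a b hx).hasDerivAt
  rw [ContinuousLinearMap.intervalIntegral_apply] at h
  · refine h.congr_deriv (intervalIntegral.integral_congr fun t _ => ?_)
    have h1 : HasFDerivAt (fun p : ℝ × ℝ => f p.1 p.2)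
        (fderiv ℝ (fun p : ℝ × ℝ => f p.1 p.2) (x, t)) (x, t) :=
      ((hf.differentiableOn one_ne_zero).differentiableAt
        (hO.mem_nhds ⟨hx, mem_univ _⟩)).hasFDerivAt
    have h2 := (HasFDerivAt.comp x (f := fun y : ℝ => (y, t)) h1
      (hasFDerivAt_prodMk_left x t)).hasDerivAt
    exact h2.unique (hf' t)
  · refine Continuous.intervalIntegrable ?_ _ _
    have hd : ContinuousOn (fun p => (fderiv ℝ (fun p : ℝ × ℝ => f p.1 p.2) p).comp
        (ContinuousLinearMap.inl ℝ ℝ ℝ)) (U ×ˢ univ) :=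
      (hf.continuousOn_fderiv_of_isOpen hO le_rfl).clm_comp continuousOn_const
    exact continuous_slice hd hx

end ParametricIntegral

/-! ### Local inverses and uniqueness of trajectories. -/

/-- A left inverse of a smooth injective map is smooth at the points over which the derivative is
invertible. -/
theorem contDiffAt_of_leftInvOn {X Y : Type*} [NormedAddCommGroup X] [NormedSpace ℝ X]
    [CompleteSpace X] [NormedAddCommGroup Y] [NormedSpace ℝ Y]
    {S : Set X} {f : X → Y} {g : Y → X} (hg : LeftInvOn g f S) (hS : IsOpen S) {x : X} (hx : x ∈ S)
    (hf : ContDiffAt ℝ ∞ f x) {f' : X ≃L[ℝ] Y} (hf' : HasFDerivAt f (f' : X →L[ℝ] Y) x) :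
    ContDiffAt ℝ ∞ g (f x) := by
  have hn : (∞ : WithTop ℕ∞) ≠ 0 := by simp
  have h1 := hf.to_localInverse hf' hn
  refine h1.congr_of_eventuallyEq ?_
  have hs := hf.hasStrictFDerivAt' hf' hn
  have h2 : ContDiffAt ℝ ∞ (hf.localInverse hf' hn) (f x) := h1
  have h3 : hf.localInverse hf' hn (f x) = x := hs.localInverse_apply_image
  have h4 : ∀ᶠ y in 𝓝 (f x), hf.localInverse hf' hn y ∈ S :=
    h2.continuousAt.eventually (by rw [h3]; exact hS.mem_nhds hx)
  -- Near `f x` the local inverse of `y` lies in `S` and is mapped back to `y`, so the left inverse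
  -- `g` must return it: both functions have the same germ.
  filter_upwards [h4, hs.eventually_right_inverse] with y hy hy'
  have := hg hy
  change f (hf.localInverse hf' hn y) = y at hy'
  rwa [hy'] at this

/-- Uniqueness for an autonomous differential equation with a `C¹` vector field on an open set. -/
theorem ode_unique_of_contDiffOn {E : Type*} [NormedAddCommGroup E] [NormedSpace ℝ E]
    {D : Set E} (hD : IsOpen D) {v : E → E} (hv : ContDiffOn ℝ 1 v D) {η₁ η₂ : ℝ → E}
    (h₁ : ∀ t ∈ Icc (0 : ℝ) 1, η₁ t ∈ D ∧ HasDerivWithinAt η₁ (v (η₁ t)) (Icc 0 1) t)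
    (h₂ : ∀ t ∈ Icc (0 : ℝ) 1, η₂ t ∈ D ∧ HasDerivWithinAt η₂ (v (η₂ t)) (Icc 0 1) t)
    (h0 : η₁ 0 = η₂ 0) : EqOn η₁ η₂ (Icc 0 1) := by
  have c₁ : ContinuousOn η₁ (Icc 0 1) := fun t ht => (h₁ t ht).2.continuousWithinAt
  have c₂ : ContinuousOn η₂ (Icc 0 1) := fun t ht => (h₂ t ht).2.continuousWithinAt
  -- A global Lipschitz constant is not available on `D`; the two trajectories together form a
  -- compact subset, on which the locally Lipschitz field is Lipschitz.
  set K : Set E := η₁ '' Icc 0 1 ∪ η₂ '' Icc 0 1 with hK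
  have hKc : IsCompact K := (isCompact_Icc.image_of_continuousOn c₁).union
    (isCompact_Icc.image_of_continuousOn c₂)
  have hKD : K ⊆ D := by
    rintro _ (⟨t, ht, rfl⟩ | ⟨t, ht, rfl⟩)
    exacts [(h₁ t ht).1, (h₂ t ht).1]
  have hL : LocallyLipschitzOn K v := by
    intro x hx
    obtain ⟨C, u, hu, hC⟩ := (hv.contDiffAt (hD.mem_nhds (hKD hx))).exists_lipschitzOnWith
    exact ⟨C, u, mem_nhdsWithin_of_mem_nhds hu, hC⟩
  obtain ⟨C, hC⟩ := hL.exists_lipschitzOnWith_of_compact hKc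
  have key : ∀ {η : ℝ → E}, (∀ t ∈ Icc (0 : ℝ) 1, η t ∈ D ∧
      HasDerivWithinAt η (v (η t)) (Icc 0 1) t) → ∀ t ∈ Ico (0 : ℝ) 1,
      HasDerivWithinAt η (v (η t)) (Ici t) t := fun h t ht =>
    (h t (Ico_subset_Icc_self ht)).2.mono_of_mem_nhdsWithin (Icc_mem_nhdsGE_of_mem ht)
  exact ODE_solution_unique_of_mem_Icc_right (v := fun _ => v) (s := fun _ => K) (K := C)
    (fun _ _ => hC) c₁ (key h₁) (fun t ht => Or.inl ⟨t, Ico_subset_Icc_self ht, rfl⟩)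
    c₂ (key h₂) (fun t ht => Or.inr ⟨t, Ico_subset_Icc_self ht, rfl⟩) h0

/-! ### The level curves as roots of a quadratic equation. -/

/-- The energies for which the level set is a closed curve around both agitator positions. -/
def energies (b R : ℝ) : Set ℝ := Ioo (b ^ 2 / R ^ 4) (1 / b ^ 2)

/-- The level `E` is `ρ ^ 2 - 2 b ^ 2 c m ρ + (b ^ 4 + R ^ 4) m - R ^ 4 = 0` with
`m = levelParam b R E`, where `ρ = |ζ| ^ 2` and `c = cos (2 arg ζ)`. -/
def levelParam (b R E : ℝ) : ℝ := (1 - E ^ 2 * R ^ 4) / (1 - E ^ 2 * b ^ 4)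

def levelParamDeriv (b R E : ℝ) : ℝ := 2 * E * (b ^ 4 - R ^ 4) / (1 - E ^ 2 * b ^ 4) ^ 2

/-- The discriminant of the quadratic equation of a level. -/
def levelDisc (b R c E : ℝ) : ℝ :=
  b ^ 4 * c ^ 2 * levelParam b R E ^ 2 - (b ^ 4 + R ^ 4) * levelParam b R E + R ^ 4

/-- Half the distance between the two roots; it depends on `c` only through `c²`. -/
def levelWidth (b R c E : ℝ) : ℝ := Real.sqrt (levelDisc b R c E)

def levelWidthDeriv (b R c E : ℝ) : ℝ :=
  levelParamDeriv b R E * (2 * b ^ 4 * c ^ 2 * levelParam b R E - (b ^ 4 + R ^ 4)) /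
    (2 * levelWidth b R c E)

/-- The squared polar radius of the level `E` in the direction with `cos (2 arg ζ) = c`. -/
def radiusSq (b R c E : ℝ) : ℝ := b ^ 2 * c * levelParam b R E + levelWidth b R c E

def radiusSqDeriv (b R c E : ℝ) : ℝ :=
  b ^ 2 * c * levelParamDeriv b R E + levelWidthDeriv b R c E

theorem isOpen_energies (b R : ℝ) : IsOpen (energies b R) := isOpen_Ioo

section Level

variable {b R c E : ℝ} (hb : 0 < b) (hbR : b < R)

theorem pow_four_lt {b R : ℝ} (hb : 0 < b) (hbR : b < R) : b ^ 4 < R ^ 4 :=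
  pow_lt_pow_left₀ hbR hb.le (by norm_num)

theorem sq_lt {b R : ℝ} (hb : 0 < b) (hbR : b < R) : b ^ 2 < R ^ 2 :=
  pow_lt_pow_left₀ hbR hb.le (by norm_num)

theorem Ioc_subset_energies {b R : ℝ} (hb : 0 < b) (hbR : b < R) :
    Ioc (b ^ 2 / R ^ 4) (1 / R ^ 2) ⊆ energies b R := fun _ hE =>
  ⟨hE.1, hE.2.trans_lt (one_div_lt_one_div_of_lt (by positivity) (sq_lt hb hbR))⟩

theorem lower_lt_boundary {b R : ℝ} (hb : 0 < b) (hbR : b < R) :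
    b ^ 2 / R ^ 4 < 1 / R ^ 2 := by
  have hR : 0 < R := hb.trans hbR
  rw [div_lt_div_iff₀ (by positivity) (by positivity)]
  nlinarith [sq_lt hb hbR, pow_pos hR 2]

theorem boundary_mem {b R : ℝ} (hb : 0 < b) (hbR : b < R) :
    1 / R ^ 2 ∈ Ioc (b ^ 2 / R ^ 4) (1 / R ^ 2) := ⟨lower_lt_boundary hb hbR, le_rfl⟩

include hb hbR

theorem energy_pos (hE : E ∈ energies b R) : 0 < E :=
  have hR : 0 < R := hb.trans hbR
  lt_trans (by positivity) hE.1

theorem levelDen_pos (hE : E ∈ energies b R) : 0 < 1 - E ^ 2 * b ^ 4 := by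
  have h0 := energy_pos hb hbR hE
  have h1 : E * b ^ 2 < 1 := (lt_div_iff₀ (by positivity)).1 hE.2
  have h2 : 0 < E * b ^ 2 := by positivity
  nlinarith

/-- This is `b⁴ < E²R⁸` after clearing the denominator: the constant term of the quadratic is
negative exactly above the energy `b²/R⁴` of the level through the origin. -/
theorem levelParam_lt (hE : E ∈ energies b R) :
    (b ^ 4 + R ^ 4) * levelParam b R E < R ^ 4 := by
  have hR : 0 < R := hb.trans hbR
  have hD := levelDen_pos hb hbR hE
  have h1 : b ^ 2 < E * R ^ 4 := (div_lt_iff₀ (by positivity)).1 hE.1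
  have h2 : 0 < b ^ 2 := by positivity
  rw [levelParam, ← mul_div_assoc, div_lt_iff₀ hD]
  nlinarith

theorem levelParamDeriv_neg (hE : E ∈ energies b R) : levelParamDeriv b R E < 0 := by
  have hD := levelDen_pos hb hbR hE
  have := energy_pos hb hbR hE
  have := pow_four_lt hb hbR
  exact div_neg_of_neg_of_pos (by nlinarith) (by positivity)

theorem hasDerivAt_levelParam (hE : E ∈ energies b R) :
    HasDerivAt (levelParam b R) (levelParamDeriv b R E) E := by
  have hD := (levelDen_pos hb hbR hE).ne'
  have h1 : HasDerivAt (fun E : ℝ => 1 - E ^ 2 * R ^ 4) (-(2 * E * R ^ 4)) E := by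
    simpa using ((hasDerivAt_pow 2 E).mul_const (R ^ 4)).const_sub 1
  have h2 : HasDerivAt (fun E : ℝ => 1 - E ^ 2 * b ^ 4) (-(2 * E * b ^ 4)) E := by
    simpa using ((hasDerivAt_pow 2 E).mul_const (b ^ 4)).const_sub 1
  refine (h1.div h2 hD).congr_deriv ?_
  rw [levelParamDeriv]
  congr 1
  ring

/-- The difference of the two sides is minus the product of the roots, so the roots have opposite
signs. -/
theorem levelDisc_gt (hE : E ∈ energies b R) :
    (b ^ 2 * c * levelParam b R E) ^ 2 < levelDisc b R c E := by
  have := levelParam_lt hb hbR hE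
  rw [levelDisc]
  nlinarith

theorem levelDisc_pos (hE : E ∈ energies b R) : 0 < levelDisc b R c E :=
  (sq_nonneg _).trans_lt (levelDisc_gt hb hbR hE)

theorem levelWidth_pos (hE : E ∈ energies b R) : 0 < levelWidth b R c E :=
  Real.sqrt_pos.2 (levelDisc_pos hb hbR hE)

theorem levelWidth_sq (hE : E ∈ energies b R) :
    levelWidth b R c E ^ 2 = levelDisc b R c E :=
  Real.sq_sqrt (levelDisc_pos hb hbR hE).le

theorem abs_lt_levelWidth (hE : E ∈ energies b R) :
    |b ^ 2 * c * levelParam b R E| < levelWidth b R c E :=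
  Real.lt_sqrt_of_sq_lt (by rw [sq_abs]; exact levelDisc_gt hb hbR hE)

theorem radiusSq_pos (hE : E ∈ energies b R) : 0 < radiusSq b R c E := by
  have := abs_lt.1 (abs_lt_levelWidth (c := c) hb hbR hE)
  rw [radiusSq]
  linarith [this.1]

theorem radiusSq_root (hE : E ∈ energies b R) :
    radiusSq b R c E ^ 2 - 2 * b ^ 2 * c * levelParam b R E * radiusSq b R c E
      + (b ^ 4 + R ^ 4) * levelParam b R E - R ^ 4 = 0 := by
  have := levelWidth_sq (c := c) hb hbR hE
  rw [levelDisc] at this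
  rw [radiusSq]
  linear_combination this

theorem eq_radiusSq_of_root (hE : E ∈ energies b R) {x : ℝ} (hx : 0 ≤ x)
    (h : x ^ 2 - 2 * b ^ 2 * c * levelParam b R E * x
      + (b ^ 4 + R ^ 4) * levelParam b R E - R ^ 4 = 0) : x = radiusSq b R c E := by
  have h1 := levelWidth_sq (c := c) hb hbR hE
  have h2 := abs_lt.1 (abs_lt_levelWidth (c := c) hb hbR hE)
  rw [levelDisc] at h1
  rw [radiusSq]
  have h3 : (x - b ^ 2 * c * levelParam b R E - levelWidth b R c E) *
      (x - b ^ 2 * c * levelParam b R E + levelWidth b R c E) = 0 := by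
    linear_combination h - h1
  rcases mul_eq_zero.1 h3 with h4 | h4
  · linarith
  · linarith [h2.2]

/-- This inequality carries the monotonicity of `ρ` in `E`, because `∂ρ/∂E = m' (2b²cρ - (b⁴ + R⁴))
/ (2W)` with `m' < 0`. If it failed, then `b⁴ + R⁴ > 2b²R²` would give `ρ > R²`, and the equation `m
(2b²cρ - (b⁴ + R⁴)) = ρ² - R⁴` would give `m > 0`. Inserting `m < R⁴/(b⁴ + R⁴)` then yields `(b⁴ +
R⁴) ρ ≤ 2b²R⁴`, which contradicts `ρ > R²`. -/
theorem radiusSq_lt (hE : E ∈ energies b R) (hc : c ≤ 1) :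
    2 * b ^ 2 * c * radiusSq b R c E < b ^ 4 + R ^ 4 := by
  have hR : 0 < R := hb.trans hbR
  have hρ := radiusSq_pos (c := c) hb hbR hE
  have hroot := radiusSq_root (c := c) hb hbR hE
  have hm := levelParam_lt hb hbR hE
  set ρ := radiusSq b R c E
  set m := levelParam b R E
  by_contra! hcon
  have h2 := sq_lt hb hbR
  have hb2 : 0 < b ^ 2 := by positivity
  have hbr : 0 < b ^ 2 * ρ := by positivity
  have h3 : b ^ 4 + R ^ 4 ≤ 2 * b ^ 2 * ρ := by nlinarith
  have h4 : R ^ 2 < ρ := by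
    have : 2 * b ^ 2 * R ^ 2 < b ^ 4 + R ^ 4 := by nlinarith
    nlinarith
  have h5 : 0 < ρ ^ 2 - R ^ 4 := by nlinarith [pow_pos hR 2]
  have h6 : m * (2 * b ^ 2 * c * ρ - (b ^ 4 + R ^ 4)) = ρ ^ 2 - R ^ 4 := by
    linear_combination -hroot
  have h7 : 0 < m := by
    by_contra! hm0
    nlinarith [mul_nonneg (neg_nonneg.2 hm0) (sub_nonneg.2 hcon)]
  have h8 : ρ ^ 2 - R ^ 4 ≤ m * (2 * b ^ 2 * ρ - (b ^ 4 + R ^ 4)) := by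
    rw [← h6]
    have : b ^ 2 * c * ρ ≤ b ^ 2 * ρ := by nlinarith
    exact mul_le_mul_of_nonneg_left (by linarith) h7.le
  have hS : 0 < b ^ 4 + R ^ 4 := by positivity
  have h9 : (b ^ 4 + R ^ 4) * (ρ ^ 2 - R ^ 4) ≤ R ^ 4 * (2 * b ^ 2 * ρ - (b ^ 4 + R ^ 4)) := by
    calc _ ≤ (b ^ 4 + R ^ 4) * (m * (2 * b ^ 2 * ρ - (b ^ 4 + R ^ 4))) :=
          mul_le_mul_of_nonneg_left h8 hS.le
      _ = ((b ^ 4 + R ^ 4) * m) * (2 * b ^ 2 * ρ - (b ^ 4 + R ^ 4)) := by ring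
      _ ≤ _ := mul_le_mul_of_nonneg_right hm.le (by linarith)
  have h10 : (b ^ 4 + R ^ 4) * ρ ^ 2 ≤ R ^ 4 * (2 * b ^ 2 * ρ) := by nlinarith
  have h11 : (b ^ 4 + R ^ 4) * ρ ≤ R ^ 4 * (2 * b ^ 2) := by
    by_contra! h
    nlinarith [mul_lt_mul_of_pos_right h hρ]
  have h12 : (b ^ 4 + R ^ 4) * R ^ 2 < R ^ 2 * (2 * b ^ 2 * R ^ 2) := by
    calc _ < (b ^ 4 + R ^ 4) * ρ := mul_lt_mul_of_pos_left h4 hS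
      _ ≤ _ := by nlinarith
  nlinarith [sq_nonneg (R ^ 2 - b ^ 2), pow_pos hR 2]

/-- Up to the boundary energy `m ≥ 0`, so by `radiusSq_lt` the quantity `ρ² - R⁴ = m (2b²cρ - (b⁴ +
R⁴))` is nonpositive. -/
theorem radiusSq_le (hE : E ∈ energies b R) (hE' : E ≤ 1 / R ^ 2) (hc : c ≤ 1) :
    radiusSq b R c E ≤ R ^ 2 := by
  have hR : 0 < R := hb.trans hbR
  have hroot := radiusSq_root (c := c) hb hbR hE
  have hlt := radiusSq_lt hb hbR hE hc
  have hm : 0 ≤ levelParam b R E := by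
    refine div_nonneg ?_ (levelDen_pos hb hbR hE).le
    have h1 : E * R ^ 2 ≤ 1 := (le_div_iff₀ (by positivity)).1 hE'
    have h2 : 0 < E * R ^ 2 := mul_pos (energy_pos hb hbR hE) (by positivity)
    nlinarith
  refine le_of_sq_le_sq ?_ (by positivity)
  nlinarith [mul_nonneg hm (sub_nonneg.2 hlt.le)]

theorem hasDerivAt_levelWidth (hE : E ∈ energies b R) :
    HasDerivAt (levelWidth b R c) (levelWidthDeriv b R c E) E := by
  have h := hasDerivAt_levelParam hb hbR hE
  have h1 : HasDerivAt (levelDisc b R c) (levelParamDeriv b R E *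
      (2 * b ^ 4 * c ^ 2 * levelParam b R E - (b ^ 4 + R ^ 4))) E := by
    refine ((((h.pow 2).const_mul (b ^ 4 * c ^ 2)).sub
      (h.const_mul (b ^ 4 + R ^ 4))).add_const (R ^ 4)).congr_deriv ?_
    norm_num
    ring
  exact h1.sqrt (levelDisc_pos hb hbR hE).ne'

theorem hasDerivAt_radiusSq (hE : E ∈ energies b R) :
    HasDerivAt (radiusSq b R c) (radiusSqDeriv b R c E) E :=
  ((hasDerivAt_levelParam hb hbR hE).const_mul (b ^ 2 * c)).add
    (hasDerivAt_levelWidth hb hbR hE)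

/-- Here `m' < 0`, and `m < 1` makes `2b⁴c²m` smaller than `b⁴ + R⁴`. -/
theorem levelWidthDeriv_pos (hE : E ∈ energies b R) (hc : c ^ 2 ≤ 1) :
    0 < levelWidthDeriv b R c E := by
  have hR : 0 < R := hb.trans hbR
  have hm := levelParam_lt hb hbR hE
  have h4 := pow_four_lt hb hbR
  have hb4 : 0 < b ^ 4 := by positivity
  refine div_pos (mul_pos_of_neg_of_neg (levelParamDeriv_neg hb hbR hE) ?_)
    (mul_pos two_pos (levelWidth_pos hb hbR hE))
  set m := levelParam b R E
  rcases le_or_gt m 0 with h0 | h0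
  · nlinarith [mul_nonneg (mul_nonneg hb4.le (sq_nonneg c)) (neg_nonneg.2 h0)]
  · have h1 : b ^ 4 * c ^ 2 * m ≤ b ^ 4 * m := by
      have := mul_le_mul_of_nonneg_left hc (mul_pos hb4 h0).le
      nlinarith
    nlinarith

theorem radiusSqDeriv_pos (hE : E ∈ energies b R) (hc : c ≤ 1) :
    0 < radiusSqDeriv b R c E := by
  have hW := levelWidth_pos (c := c) hb hbR hE
  have h := radiusSq_lt hb hbR hE hc
  have h' : radiusSqDeriv b R c E = levelParamDeriv b R E *
      (2 * b ^ 2 * c * radiusSq b R c E - (b ^ 4 + R ^ 4)) / (2 * levelWidth b R c E) := by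
    rw [radiusSqDeriv, levelWidthDeriv, radiusSq]
    field_simp
    ring
  rw [h']
  exact div_pos (mul_pos_of_neg_of_neg (levelParamDeriv_neg hb hbR hE) (by linarith))
    (mul_pos two_pos hW)

theorem contDiffAt_levelParam (hE : E ∈ energies b R) : ContDiffAt ℝ ∞ (levelParam b R) E :=
  ContDiffAt.div (by fun_prop) (by fun_prop) (levelDen_pos hb hbR hE).ne'

theorem contDiffAt_levelParamDeriv (hE : E ∈ energies b R) :
    ContDiffAt ℝ ∞ (levelParamDeriv b R) E :=
  ContDiffAt.div (by fun_prop) (by fun_prop) (pow_ne_zero _ (levelDen_pos hb hbR hE).ne')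

variable {X : Type*} [NormedAddCommGroup X] [NormedSpace ℝ X] {f g : X → ℝ} {x : X}

theorem contDiffAt_levelWidth (hf : ContDiffAt ℝ ∞ f x) (hg : ContDiffAt ℝ ∞ g x)
    (hE : g x ∈ energies b R) : ContDiffAt ℝ ∞ (fun y => levelWidth b R (f y) (g y)) x := by
  have hm := (contDiffAt_levelParam hb hbR hE).comp x hg
  refine ContDiffAt.sqrt ?_ (levelDisc_pos hb hbR hE).ne'
  exact (((contDiffAt_const.mul (hf.pow 2)).mul (hm.pow 2)).sub
    (contDiffAt_const.mul hm)).add contDiffAt_const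

theorem contDiffAt_levelWidthDeriv (hf : ContDiffAt ℝ ∞ f x) (hg : ContDiffAt ℝ ∞ g x)
    (hE : g x ∈ energies b R) :
    ContDiffAt ℝ ∞ (fun y => levelWidthDeriv b R (f y) (g y)) x := by
  have hm := (contDiffAt_levelParam hb hbR hE).comp x hg
  have hm' := (contDiffAt_levelParamDeriv hb hbR hE).comp x hg
  exact (hm'.mul (((contDiffAt_const.mul (hf.pow 2)).mul hm).sub contDiffAt_const)).div
    (contDiffAt_const.mul (contDiffAt_levelWidth hb hbR hf hg hE))
    (mul_pos two_pos (levelWidth_pos hb hbR hE)).ne'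

theorem contDiffAt_radiusSq (hf : ContDiffAt ℝ ∞ f x) (hg : ContDiffAt ℝ ∞ g x)
    (hE : g x ∈ energies b R) : ContDiffAt ℝ ∞ (fun y => radiusSq b R (f y) (g y)) x :=
  ((contDiffAt_const.mul hf).mul ((contDiffAt_levelParam hb hbR hE).comp x hg)).add
    (contDiffAt_levelWidth hb hbR hf hg hE)

theorem contDiffAt_radiusSqDeriv (hf : ContDiffAt ℝ ∞ f x) (hg : ContDiffAt ℝ ∞ g x)
    (hE : g x ∈ energies b R) : ContDiffAt ℝ ∞ (fun y => radiusSqDeriv b R (f y) (g y)) x :=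
  ((contDiffAt_const.mul hf).mul ((contDiffAt_levelParamDeriv hb hbR hE).comp x hg)).add
    (contDiffAt_levelWidthDeriv hb hbR hf hg hE)

end Level

/-! ### The action integral and its derivatives. -/

theorem cos_sq_le (t : ℝ) : Real.cos t ^ 2 ≤ 1 := by
  nlinarith [Real.sin_sq_add_cos_sq t, sq_nonneg (Real.sin t)]

/-- The derivative of the action. -/
def actionDeriv (b R E : ℝ) : ℝ :=
  1 / Real.pi * ∫ ψ in (0 : ℝ)..(Real.pi / 2), levelWidthDeriv b R (Real.cos (2 * ψ)) E

section Action

variable {b R E : ℝ} (hb : 0 < b) (hbR : b < R)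
include hb hbR

theorem contDiffOn_levelWidth_angle :
    ContDiffOn ℝ ∞ (fun p : ℝ × ℝ => levelWidth b R (Real.cos (2 * p.2)) p.1)
      (energies b R ×ˢ univ) := fun p hp =>
  (contDiffAt_levelWidth hb hbR (f := fun p : ℝ × ℝ => Real.cos (2 * p.2)) (by fun_prop)
    contDiffAt_fst hp.1).contDiffWithinAt

theorem contDiffOn_levelWidthDeriv_angle :
    ContDiffOn ℝ ∞ (fun p : ℝ × ℝ => levelWidthDeriv b R (Real.cos (2 * p.2)) p.1)
      (energies b R ×ˢ univ) := fun p hp =>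
  (contDiffAt_levelWidthDeriv hb hbR (f := fun p : ℝ × ℝ => Real.cos (2 * p.2)) (by fun_prop)
    contDiffAt_fst hp.1).contDiffWithinAt

/-- The positive factor `2(1 - E²b⁴)` comes out of the root. The result is the enclosed area `½ ∫ ρ
dψ` over `2π`: the summand of `ρ` linear in `cos 2ψ` has mean zero, and the four quadrants
contribute equally to the rest. -/
theorem action_eq (hE : E ∈ energies b R) : action b R E =
    1 / Real.pi * ∫ ψ in (0 : ℝ)..(Real.pi / 2), levelWidth b R (Real.cos (2 * ψ)) E := by
  have hD := levelDen_pos hb hbR hE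
  have key : ∀ ψ : ℝ, Real.sqrt (4 * b ^ 4 * (1 - E ^ 2 * R ^ 4) ^ 2 * Real.cos (2 * ψ) ^ 2
        + 4 * (E ^ 2 * b ^ 4 - 1) * (b ^ 4 - E ^ 2 * R ^ 8)) =
      2 * (1 - E ^ 2 * b ^ 4) * levelWidth b R (Real.cos (2 * ψ)) E := by
    intro ψ
    rw [levelWidth, ← Real.sqrt_sq (mul_pos two_pos hD).le, ← Real.sqrt_mul (sq_nonneg _)]
    congr 1
    have hm : levelParam b R E * (1 - E ^ 2 * b ^ 4) = 1 - E ^ 2 * R ^ 4 :=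
      div_mul_cancel₀ _ hD.ne'
    rw [levelDisc]
    linear_combination (-(4 * b ^ 4 * Real.cos (2 * ψ) ^ 2) *
      (levelParam b R E * (1 - E ^ 2 * b ^ 4) + (1 - E ^ 2 * R ^ 4)) +
      4 * (b ^ 4 + R ^ 4) * (1 - E ^ 2 * b ^ 4)) * hm
  simp_rw [action, key]
  rw [intervalIntegral.integral_const_mul]
  field_simp

theorem contDiffOn_action : ContDiffOn ℝ ∞ (action b R) (energies b R) :=
  (contDiffOn_const.mul (contDiffOn_intervalIntegral_param (isOpen_energies b R)
    (contDiffOn_levelWidth_angle hb hbR) 0 (Real.pi / 2))).congr fun _ hE => action_eq hb hbR hE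

theorem contDiffOn_actionDeriv : ContDiffOn ℝ ∞ (actionDeriv b R) (energies b R) :=
  contDiffOn_const.mul (contDiffOn_intervalIntegral_param (isOpen_energies b R)
    (contDiffOn_levelWidthDeriv_angle hb hbR) 0 (Real.pi / 2))

theorem contDiffAt_action (hE : E ∈ energies b R) : ContDiffAt ℝ ∞ (action b R) E :=
  (contDiffOn_action hb hbR).contDiffAt ((isOpen_energies b R).mem_nhds hE)

theorem contDiffAt_actionDeriv (hE : E ∈ energies b R) : ContDiffAt ℝ ∞ (actionDeriv b R) E :=
  (contDiffOn_actionDeriv hb hbR).contDiffAt ((isOpen_energies b R).mem_nhds hE)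

theorem hasDerivAt_action (hE : E ∈ energies b R) :
    HasDerivAt (action b R) (actionDeriv b R E) E := by
  have h := (hasDerivAt_intervalIntegral_param (isOpen_energies b R)
    (f := fun E t => levelWidth b R (Real.cos (2 * t)) E)
    (f' := fun E t => levelWidthDeriv b R (Real.cos (2 * t)) E)
    ((contDiffOn_levelWidth_angle hb hbR).of_le (by simp)) 0 (Real.pi / 2) hE
    (fun t => hasDerivAt_levelWidth hb hbR hE)).const_mul (1 / Real.pi)
  refine h.congr_of_eventuallyEq ?_
  filter_upwards [(isOpen_energies b R).mem_nhds hE] with x hx using action_eq hb hbR hx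

theorem deriv_action (hE : E ∈ energies b R) : deriv (action b R) E = actionDeriv b R E :=
  (hasDerivAt_action hb hbR hE).deriv

theorem deriv_deriv_action (hE : E ∈ energies b R) :
    deriv (deriv (action b R)) E = deriv (actionDeriv b R) E := by
  refine EventuallyEq.deriv_eq ?_
  filter_upwards [(isOpen_energies b R).mem_nhds hE] with x hx using deriv_action hb hbR hx

theorem continuous_levelWidthDeriv_angle (hE : E ∈ energies b R) :
    Continuous fun t => levelWidthDeriv b R (Real.cos (2 * t)) E :=
  continuous_slice (contDiffOn_levelWidthDeriv_angle hb hbR).continuousOn hE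

theorem action_pos (hE : E ∈ energies b R) : 0 < action b R E := by
  rw [action_eq hb hbR hE]
  refine mul_pos (by positivity) (intervalIntegral.intervalIntegral_pos_of_pos ?_
    (fun t => levelWidth_pos hb hbR hE) (by positivity))
  exact (continuous_slice (contDiffOn_levelWidth_angle hb hbR).continuousOn
    hE).intervalIntegrable _ _

theorem actionDeriv_pos (hE : E ∈ energies b R) : 0 < actionDeriv b R E :=
  mul_pos (by positivity) (intervalIntegral.intervalIntegral_pos_of_pos
    ((continuous_levelWidthDeriv_angle hb hbR hE).intervalIntegrable _ _)
    (fun t => levelWidthDeriv_pos hb hbR hE (cos_sq_le _)) (by positivity))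

theorem strictMonoOn_action : StrictMonoOn (action b R) (energies b R) :=
  strictMonoOn_of_deriv_pos (convex_Ioo _ _) (contDiffOn_action hb hbR).continuousOn
    fun E hE => by
      have hE' := interior_subset hE
      rw [deriv_action hb hbR hE']
      exact actionDeriv_pos hb hbR hE'

theorem levelParam_boundary : levelParam b R (1 / R ^ 2) = 0 := by
  have hR : R ≠ 0 := (hb.trans hbR).ne'
  have : 1 - (1 / R ^ 2) ^ 2 * R ^ 4 = 0 := by field_simp; ring
  rw [levelParam, this, zero_div]

theorem levelWidth_boundary (c : ℝ) : levelWidth b R c (1 / R ^ 2) = R ^ 2 := by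
  rw [levelWidth, levelDisc, levelParam_boundary hb hbR, ← Real.sqrt_sq (sq_nonneg R)]
  congr 1
  ring

theorem action_boundary : action b R (1 / R ^ 2) = R ^ 2 / 2 := by
  rw [action_eq hb hbR (Ioc_subset_energies hb hbR (boundary_mem hb hbR))]
  simp_rw [levelWidth_boundary hb hbR]
  rw [intervalIntegral.integral_const, smul_eq_mul]
  field_simp
  ring

/-- At the boundary energy the function `E W'(E)` is strictly increasing. -/
theorem hasDerivAt_mul_levelWidthDeriv_boundary (c : ℝ) :
    HasDerivAt (fun E => E * levelWidthDeriv b R c E)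
      (R ^ 8 / (R ^ 4 - b ^ 4) ^ 2 * (4 * b ^ 4 * c ^ 2 / R ^ 2 + (R ^ 4 + b ^ 4) ^ 2 / R ^ 6)
        / (1 / R ^ 2)) (1 / R ^ 2) := by
  have hR : 0 < R := hb.trans hbR
  have hE := Ioc_subset_energies hb hbR (boundary_mem hb hbR)
  have h4 := pow_four_lt hb hbR
  have hD := levelDen_pos hb hbR hE
  have h := hasDerivAt_levelParam hb hbR hE
  have hW := hasDerivAt_levelWidth (c := c) hb hbR hE
  have h2 : HasDerivAt (fun E : ℝ => 1 - E ^ 2 * b ^ 4) (-(2 * (1 / R ^ 2) * b ^ 4))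
      (1 / R ^ 2) := by
    simpa [-one_div] using ((hasDerivAt_pow 2 (1 / R ^ 2)).mul_const (b ^ 4)).const_sub 1
  have h3 : HasDerivAt (levelParamDeriv b R) _ (1 / R ^ 2) :=
    (((hasDerivAt_id (1 / R ^ 2)).const_mul 2).mul_const (b ^ 4 - R ^ 4)).div (h2.pow 2)
      (pow_ne_zero 2 hD.ne')
  have h5 : HasDerivAt (levelWidthDeriv b R c) _ (1 / R ^ 2) :=
    (h3.mul ((h.const_mul (2 * b ^ 4 * c ^ 2)).sub_const (b ^ 4 + R ^ 4))).div
      (hW.const_mul 2) (mul_pos two_pos (levelWidth_pos hb hbR hE)).ne'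
  -- The claimed value is `d²W/d(ln E)²` at `m = 0`, divided by `E = 1/R²`. In units of `R⁸/(R⁴ -
  -- b⁴)²`, the square root contributes `-(R⁴ + b⁴)²/R⁶` and the second derivative of `m`
  -- contributes twice its opposite, which leaves a positive sum.
  refine ((hasDerivAt_id (1 / R ^ 2)).mul h5).congr_deriv ?_
  have hD' : R ^ 4 - b ^ 4 ≠ 0 := by linarith
  have hD2 : 1 - (1 / R ^ 2) ^ 2 * b ^ 4 = (R ^ 4 - b ^ 4) / R ^ 4 := by
    field_simp
  simp only [levelWidthDeriv, levelWidth_boundary hb hbR, levelParam_boundary hb hbR,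
    levelParamDeriv, hD2, Pi.mul_apply, Nat.add_one_sub_one, pow_one, Nat.cast_ofNat]
  field_simp
  ring

end Action

/-! ### The twist condition and its interval of energies. -/

/-- The connected component of the right end point in a relatively open subset of `(a, c]`. -/
theorem connectedComponentIn_eq_Ioc {a c : ℝ} {S : Set ℝ} (hS : S ⊆ Ioc a c) (hc : c ∈ S)
    (hopen : ∀ x ∈ S, ∀ᶠ y in 𝓝 x, y ≤ x → y ∈ S) :
    ∃ Es ∈ Ico a c, connectedComponentIn S c = Ioc Es c := by
  set C := connectedComponentIn S c with hC
  have hCS : C ⊆ S := connectedComponentIn_subset S c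
  have hcC : c ∈ C := mem_connectedComponentIn hc
  have hord : C.OrdConnected := isPreconnected_connectedComponentIn.ordConnected
  have hbdd : BddBelow C := ⟨a, fun x hx => (hS (hCS hx)).1.le⟩
  -- A left neighbourhood of each point of the component lies in `S` and joins the component, so the
  -- infimum is not attained.
  have hlt : ∀ x ∈ C, sInf C < x := by
    intro x hx
    obtain ⟨ε, hε, h⟩ := Metric.eventually_nhds_iff.1 (hopen x (hCS hx))
    have hsub : Ioc (x - ε) x ⊆ S := fun y hy =>
      h (by rw [Real.dist_eq, abs_lt]; constructor <;> linarith [hy.1, hy.2]) hy.2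
    have h1 : Ioc (x - ε) x ⊆ C := by
      rw [hC, connectedComponentIn_eq hx]
      exact isPreconnected_Ioc.subset_connectedComponentIn ⟨by linarith, le_rfl⟩ hsub
    have h2 : sInf C ≤ x - ε / 2 := csInf_le hbdd (h1 ⟨by linarith, by linarith⟩)
    linarith
  refine ⟨sInf C, ⟨le_csInf ⟨c, hcC⟩ fun x hx => (hS (hCS hx)).1.le, hlt c hcC⟩, ?_⟩
  ext x
  refine ⟨fun hx => ⟨hlt x hx, (hS (hCS hx)).2⟩, fun hx => ?_⟩
  obtain ⟨y, hy, hyx⟩ := exists_lt_of_csInf_lt ⟨c, hcC⟩ hx.1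
  exact hord.out hy hcC ⟨hyx.le, hx.2⟩

/-- The quantity `E I''(E) + I'(E)`. -/
def twist (b R E : ℝ) : ℝ := E * deriv (actionDeriv b R) E + actionDeriv b R E

section Twist

variable {b R : ℝ} (hb : 0 < b) (hbR : b < R)
include hb hbR

/-- The twist is the derivative of `E I'(E)`, which is the mean of `E W'(E)` up to a positive
factor; at `1/R²` each integrand already has positive derivative. -/
theorem twist_boundary_pos : 0 < twist b R (1 / R ^ 2) := by
  have hR : 0 < R := hb.trans hbR
  have hE := Ioc_subset_energies hb hbR (boundary_mem hb hbR)
  have h4 := pow_four_lt hb hbR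
  have h1 := (hasDerivAt_intervalIntegral_param (isOpen_energies b R)
    (f := fun E t => E * levelWidthDeriv b R (Real.cos (2 * t)) E)
    (f' := fun _ t => R ^ 8 / (R ^ 4 - b ^ 4) ^ 2 * (4 * b ^ 4 * Real.cos (2 * t) ^ 2 / R ^ 2
      + (R ^ 4 + b ^ 4) ^ 2 / R ^ 6) / (1 / R ^ 2))
    ((contDiffOn_fst.mul (contDiffOn_levelWidthDeriv_angle hb hbR)).of_le (by simp))
    0 (Real.pi / 2) hE (fun t => hasDerivAt_mul_levelWidthDeriv_boundary hb hbR _)).const_mul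
      (1 / Real.pi)
  have h2 : HasDerivAt (fun E => E * actionDeriv b R E) (twist b R (1 / R ^ 2)) (1 / R ^ 2) := by
    have := (hasDerivAt_id (1 / R ^ 2)).mul
      (((contDiffAt_actionDeriv hb hbR hE).differentiableAt (by simp)).hasDerivAt)
    refine this.congr_deriv ?_
    simp only [twist, id]
    ring
  have h3 : (fun E => E * actionDeriv b R E) = fun E => 1 / Real.pi *
      ∫ t in (0 : ℝ)..(Real.pi / 2), E * levelWidthDeriv b R (Real.cos (2 * t)) E := by
    funext E
    rw [intervalIntegral.integral_const_mul, actionDeriv]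
    ring
  rw [h3] at h2
  rw [h2.unique h1]
  refine mul_pos (by positivity) (intervalIntegral.intervalIntegral_pos_of_pos ?_ ?_
    (by positivity))
  · exact Continuous.intervalIntegrable (by fun_prop) _ _
  · intro t
    have : R ^ 4 - b ^ 4 ≠ 0 := by linarith
    positivity

theorem continuousOn_twist : ContinuousOn (twist b R) (energies b R) := by
  have h := contDiffOn_actionDeriv hb hbR
  exact (continuousOn_id.mul (h.continuousOn_deriv_of_isOpen (isOpen_energies b R)
    (by simp))).add h.continuousOn

/-- The condition `I' ≠ 0` is automatic because `I' > 0`. -/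
theorem mem_regularEnergies_iff {E : ℝ} :
    E ∈ regularEnergies b R ↔ E ∈ Ioc (b ^ 2 / R ^ 4) (1 / R ^ 2) ∧ twist b R E ≠ 0 := by
  refine and_congr_right fun hE => ?_
  have hE' := Ioc_subset_energies hb hbR hE
  rw [deriv_deriv_action hb hbR hE', deriv_action hb hbR hE']
  exact and_iff_right (actionDeriv_pos hb hbR hE').ne'

theorem boundary_mem_regularEnergies : 1 / R ^ 2 ∈ regularEnergies b R :=
  (mem_regularEnergies_iff hb hbR).2 ⟨boundary_mem hb hbR, (twist_boundary_pos hb hbR).ne'⟩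

theorem exists_twistEnergies_eq :
    ∃ Es ∈ Ico (b ^ 2 / R ^ 4) (1 / R ^ 2), twistEnergies b R = Ioc Es (1 / R ^ 2) := by
  refine connectedComponentIn_eq_Ioc (fun E hE => hE.1) (boundary_mem_regularEnergies hb hbR) ?_
  intro x hx
  rw [mem_regularEnergies_iff hb hbR] at hx
  have hc := (continuousOn_twist hb hbR).continuousAt
    ((isOpen_energies b R).mem_nhds (Ioc_subset_energies hb hbR hx.1))
  filter_upwards [hc.eventually_ne hx.2, lt_mem_nhds hx.1.1] with y hy hy' hyx
  exact (mem_regularEnergies_iff hb hbR).2 ⟨⟨hy', hyx.trans hx.1.2⟩, hy⟩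

/-- A nonpositive value would, by connectedness and positivity at `1/R²`, force a zero inside the
component. -/
theorem twist_pos {E : ℝ} (hE : E ∈ twistEnergies b R) : 0 < twist b R E := by
  have hsub : twistEnergies b R ⊆ regularEnergies b R := connectedComponentIn_subset _ _
  by_contra! h
  obtain ⟨x, hx, h0⟩ := isPreconnected_connectedComponentIn.intermediate_value hE
    (mem_connectedComponentIn (boundary_mem_regularEnergies hb hbR))
    ((continuousOn_twist hb hbR).mono fun x hx => Ioc_subset_energies hb hbR (hsub hx).1)
    ⟨h, (twist_boundary_pos hb hbR).le⟩
  exact ((mem_regularEnergies_iff hb hbR).1 (hsub hx)).2 h0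

theorem Icc_subset_twistEnergies {E₀ : ℝ}
    (hE₀ : E₀ ∈ Ioo (sInf (twistEnergies b R)) (1 / R ^ 2)) :
    Icc E₀ (1 / R ^ 2) ⊆ twistEnergies b R := by
  obtain ⟨Es, hEs, h⟩ := exists_twistEnergies_eq hb hbR
  rw [h, csInf_Ioc hEs.2] at hE₀
  rw [h]
  exact fun x hx => ⟨hE₀.1.trans_le hx.1, hx.2⟩

theorem twistEnergies_subset : twistEnergies b R ⊆ energies b R := fun _ hx =>
  Ioc_subset_energies hb hbR (connectedComponentIn_subset _ _ hx).1

end Twist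

/-- Differentiate `g ∘ f = id` and cancel the invertible derivative of `f`. -/
theorem hasFDerivAt_of_leftInvOn {X Y : Type*} [NormedAddCommGroup X] [NormedSpace ℝ X]
    [NormedAddCommGroup Y] [NormedSpace ℝ Y]
    {S : Set X} {f : X → Y} {g : Y → X} (hg : LeftInvOn g f S) (hS : IsOpen S) {x : X} (hx : x ∈ S)
    {f' : X ≃L[ℝ] Y} (hf' : HasFDerivAt f (f' : X →L[ℝ] Y) x) (hd : DifferentiableAt ℝ g (f x)) :
    HasFDerivAt g (f'.symm : Y →L[ℝ] X) (f x) := by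
  have h1 := hd.hasFDerivAt.comp x hf'
  have h2 : HasFDerivAt (g ∘ f) (ContinuousLinearMap.id ℝ X) x :=
    (hasFDerivAt_id x).congr_of_eventuallyEq (by
      filter_upwards [hS.mem_nhds hx] with y hy using hg hy)
  have h3 := h1.unique h2
  convert hd.hasFDerivAt using 1
  ext y
  have := DFunLike.congr_fun h3 (f'.symm y)
  simpa using this.symm

/-! ### The energy as a function of the action. -/

/-- The inverse of the action. -/
def energyInv (b R : ℝ) : ℝ → ℝ := Function.invFunOn (action b R) (energies b R)

/-- The energy as a smooth function of the action on a neighbourhood of `[I₀, R² / 2]`. -/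
def extEnergy (b R Γ J : ℝ) : ℝ := Γ / (4 * Real.pi) * Real.log (energyInv b R J)

/-- The angular frequency of the level `E`. -/
def frequency (b R Γ E : ℝ) : ℝ := Γ / (4 * Real.pi) * (E * actionDeriv b R E)⁻¹

section Inverse

variable {b R : ℝ} (hb : 0 < b) (hbR : b < R)
include hb hbR

theorem leftInvOn_energyInv : LeftInvOn (energyInv b R) (action b R) (energies b R) :=
  (strictMonoOn_action hb hbR).injOn.leftInvOn_invFunOn

variable {E : ℝ} (hE : E ∈ energies b R)
include hE

theorem hasFDerivAt_action_equiv : HasFDerivAt (action b R)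
    ((ContinuousLinearEquiv.unitsEquivAut ℝ
      (Units.mk0 _ (actionDeriv_pos hb hbR hE).ne') : ℝ ≃L[ℝ] ℝ) : ℝ →L[ℝ] ℝ) E := by
  refine (hasDerivAt_action hb hbR hE).hasFDerivAt.congr_fderiv ?_
  ext
  simp

theorem contDiffAt_energyInv : ContDiffAt ℝ ∞ (energyInv b R) (action b R E) :=
  contDiffAt_of_leftInvOn (leftInvOn_energyInv hb hbR) (isOpen_energies b R) hE
    (contDiffAt_action hb hbR hE) (hasFDerivAt_action_equiv hb hbR hE)

theorem hasDerivAt_energyInv :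
    HasDerivAt (energyInv b R) (actionDeriv b R E)⁻¹ (action b R E) := by
  have h := hasFDerivAt_of_leftInvOn (leftInvOn_energyInv hb hbR) (isOpen_energies b R) hE
    (hasFDerivAt_action_equiv hb hbR hE)
    ((contDiffAt_energyInv hb hbR hE).differentiableAt (by simp))
  refine h.hasDerivAt.congr_deriv ?_
  simp [ContinuousLinearEquiv.unitsEquivAut_apply_symm]

theorem energyInv_action : energyInv b R (action b R E) = E := leftInvOn_energyInv hb hbR hE

theorem contDiffAt_extEnergy (Γ : ℝ) : ContDiffAt ℝ ∞ (extEnergy b R Γ) (action b R E) := by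
  refine contDiffAt_const.mul ((contDiffAt_energyInv hb hbR hE).log ?_)
  rw [energyInv_action hb hbR hE]
  exact (energy_pos hb hbR hE).ne'

theorem hasDerivAt_extEnergy (Γ : ℝ) :
    HasDerivAt (extEnergy b R Γ) (frequency b R Γ E) (action b R E) := by
  have h0 := energyInv_action hb hbR hE
  have hE0 := (energy_pos hb hbR hE).ne'
  refine (((hasDerivAt_energyInv hb hbR hE).log (by rwa [h0])).const_mul _).congr_deriv ?_
  rw [h0, frequency, mul_inv, div_eq_mul_inv]
  ring

/-- The derivative of `1/(E I')` produces the factor `-(E I')'`; this is where the twist condition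
enters `Ĥ''`. -/
theorem hasDerivAt_frequency_energyInv (Γ : ℝ) :
    HasDerivAt (fun J => frequency b R Γ (energyInv b R J))
      (Γ / (4 * Real.pi) * (-twist b R E / (E * actionDeriv b R E) ^ 2) *
        (actionDeriv b R E)⁻¹) (action b R E) := by
  have h0 := energyInv_action hb hbR hE
  have hne := (mul_pos (energy_pos hb hbR hE) (actionDeriv_pos hb hbR hE)).ne'
  have h1 : HasDerivAt (fun E => E * actionDeriv b R E) (twist b R E) E := by
    have := (hasDerivAt_id E).mul
      (((contDiffAt_actionDeriv hb hbR hE).differentiableAt (by simp)).hasDerivAt)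
    refine this.congr_deriv ?_
    simp only [twist, id]
    ring
  have h2 : HasDerivAt (frequency b R Γ)
      (Γ / (4 * Real.pi) * (-twist b R E / (E * actionDeriv b R E) ^ 2))
      (energyInv b R (action b R E)) := by
    rw [h0]
    exact (h1.inv hne).const_mul (Γ / (4 * Real.pi))
  exact h2.comp (action b R E) (hasDerivAt_energyInv hb hbR hE)

end Inverse

/-! ### The energy on the closed interval of actions, and its concavity. -/

section Annulus

variable {b R E₀ : ℝ} (hb : 0 < b) (hbR : b < R)
  (hE₀ : E₀ ∈ Ioo (sInf (twistEnergies b R)) (1 / R ^ 2))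
include hb hbR hE₀

theorem Icc_subset_energies : Icc E₀ (1 / R ^ 2) ⊆ energies b R :=
  (Icc_subset_twistEnergies hb hbR hE₀).trans (twistEnergies_subset hb hbR)

theorem bijOn_action : BijOn (action b R) (Icc E₀ (1 / R ^ 2))
    (Icc (action b R E₀) (R ^ 2 / 2)) := by
  have hsub := Icc_subset_energies hb hbR hE₀
  have hmono := (strictMonoOn_action hb hbR).mono hsub
  have hcont := (contDiffOn_action hb hbR).continuousOn.mono hsub
  have hb' := action_boundary hb hbR
  refine ⟨fun E hE => ⟨?_, ?_⟩, hmono.injOn, ?_⟩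
  · exact hmono.monotoneOn (left_mem_Icc.2 hE₀.2.le) hE hE.1
  · rw [← hb']
    exact hmono.monotoneOn hE (right_mem_Icc.2 hE₀.2.le) hE.2
  · rw [← hb']
    exact intermediate_value_Icc hE₀.2.le hcont

theorem action_lt_half : action b R E₀ < R ^ 2 / 2 := by
  have hsub := Icc_subset_energies hb hbR hE₀
  rw [← action_boundary hb hbR]
  exact strictMonoOn_action hb hbR (hsub (left_mem_Icc.2 hE₀.2.le))
    (hsub (right_mem_Icc.2 hE₀.2.le)) hE₀.2

/-- On the closed interval the inverse agrees with the one defined on a neighbourhood, so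
derivatives within the interval, end points included, come from ordinary ones. -/
theorem energyOfAction_eqOn (Γ : ℝ) : EqOn (energyOfAction b R Γ E₀) (extEnergy b R Γ)
    (Icc (action b R E₀) (R ^ 2 / 2)) := by
  intro J hJ
  have hbij := bijOn_action hb hbR hE₀
  obtain ⟨E, hE, rfl⟩ := hbij.surjOn hJ
  rw [energyOfAction, extEnergy, hbij.injOn.leftInvOn_invFunOn hE,
    energyInv_action hb hbR (Icc_subset_energies hb hbR hE₀ hE)]

theorem contDiffOn_energyOfAction (Γ : ℝ) : ContDiffOn ℝ ∞ (energyOfAction b R Γ E₀)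
    (Icc (action b R E₀) (R ^ 2 / 2)) := by
  refine ContDiffOn.congr (fun J hJ => ?_) (energyOfAction_eqOn hb hbR hE₀ Γ)
  obtain ⟨E, hE, rfl⟩ := (bijOn_action hb hbR hE₀).surjOn hJ
  exact (contDiffAt_extEnergy hb hbR (Icc_subset_energies hb hbR hE₀ hE) Γ).contDiffWithinAt

theorem derivWithin_energyOfAction (Γ : ℝ) {J : ℝ}
    (hJ : J ∈ Icc (action b R E₀) (R ^ 2 / 2)) :
    derivWithin (energyOfAction b R Γ E₀) (Icc (action b R E₀) (R ^ 2 / 2)) J =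
      frequency b R Γ (energyInv b R J) := by
  have hu := uniqueDiffOn_Icc (action_lt_half hb hbR hE₀) J hJ
  rw [derivWithin_congr (energyOfAction_eqOn hb hbR hE₀ Γ) (energyOfAction_eqOn hb hbR hE₀ Γ hJ)]
  obtain ⟨E, hE, rfl⟩ := (bijOn_action hb hbR hE₀).surjOn hJ
  have hE' := Icc_subset_energies hb hbR hE₀ hE
  rw [energyInv_action hb hbR hE']
  exact (hasDerivAt_extEnergy hb hbR hE' Γ).hasDerivWithinAt.derivWithin hu

theorem derivWithin_derivWithin_energyOfAction_neg {Γ : ℝ} (hΓ : 0 < Γ) {J : ℝ}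
    (hJ : J ∈ Icc (action b R E₀) (R ^ 2 / 2)) :
    derivWithin (derivWithin (energyOfAction b R Γ E₀) (Icc (action b R E₀) (R ^ 2 / 2)))
      (Icc (action b R E₀) (R ^ 2 / 2)) J < 0 := by
  have hu := uniqueDiffOn_Icc (action_lt_half hb hbR hE₀) J hJ
  rw [derivWithin_congr (fun J hJ => derivWithin_energyOfAction hb hbR hE₀ Γ hJ)
    (derivWithin_energyOfAction hb hbR hE₀ Γ hJ)]
  obtain ⟨E, hE, rfl⟩ := (bijOn_action hb hbR hE₀).surjOn hJ
  have hE' := Icc_subset_energies hb hbR hE₀ hE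
  rw [(hasDerivAt_frequency_energyInv hb hbR hE' Γ).hasDerivWithinAt.derivWithin hu]
  have h1 := twist_pos hb hbR (Icc_subset_twistEnergies hb hbR hE₀ hE)
  have h2 := actionDeriv_pos hb hbR hE'
  have h3 := energy_pos hb hbR hE'
  rw [neg_div, mul_neg, neg_mul]
  exact neg_neg_of_pos (by positivity)

theorem iteratedDerivWithin_energyOfAction_neg {Γ : ℝ} (hΓ : 0 < Γ) {J : ℝ}
    (hJ : J ∈ Icc (action b R E₀) (R ^ 2 / 2)) :
    iteratedDerivWithin 2 (energyOfAction b R Γ E₀) (Icc (action b R E₀) (R ^ 2 / 2)) J < 0 := by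
  rw [iteratedDerivWithin_succ, iteratedDerivWithin_one]
  exact derivWithin_derivWithin_energyOfAction_neg hb hbR hE₀ hΓ hJ

end Annulus

/-! ### The level curves in the plane. -/

/-- The point of the level curve `E` with polar angle `ψ`, as a function of `(ψ, E)`. -/
def levelPoint (b R : ℝ) (p : ℝ × ℝ) : ℂ :=
  (Real.sqrt (radiusSq b R (Real.cos (2 * p.1)) p.2) : ℂ) * Complex.exp (p.1 * Complex.I)

/-- The law of cosines. The pairs `a = 1`, `x = b²` and `a = b²`, `x = R⁴` give the two sides of the
level equation. -/
theorem sq_norm_mul_polar_sub (x a ρ φ : ℝ) :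
    ‖(a : ℂ) * (ρ * Complex.exp (φ * Complex.I)) - x‖ ^ 2 =
      a ^ 2 * ρ ^ 2 - 2 * (a * ρ * x * Real.cos φ) + x ^ 2 := by
  rw [Complex.sq_norm, Complex.normSq_apply, Complex.exp_mul_I, ← Complex.ofReal_cos,
    ← Complex.ofReal_sin]
  simp only [Complex.sub_re, Complex.sub_im, Complex.add_re, Complex.add_im, Complex.ofReal_re, Complex.ofReal_im, Complex.mul_re,
    Complex.mul_im, Complex.I_re, Complex.I_im]
  linear_combination (a * ρ) ^ 2 * Real.sin_sq_add_cos_sq φ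

theorem polar_sq (r ψ : ℝ) : ((r : ℂ) * Complex.exp (ψ * Complex.I)) ^ 2 =
    ((r ^ 2 : ℝ) : ℂ) * Complex.exp ((2 * ψ : ℝ) * Complex.I) := by
  rw [mul_pow, ← Complex.exp_nat_mul]
  push_cast
  ring_nf

theorem norm_levelPoint (b R : ℝ) (p : ℝ × ℝ) :
    ‖levelPoint b R p‖ = Real.sqrt (radiusSq b R (Real.cos (2 * p.1)) p.2) := by
  rw [levelPoint, norm_mul, Complex.norm_exp_ofReal_mul_I, mul_one, Complex.norm_real,
    Real.norm_of_nonneg (Real.sqrt_nonneg _)]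

section Geometry

variable {b R : ℝ} (hb : 0 < b) (hbR : b < R)

theorem mem_domain_iff {b R : ℝ} (hb : b ≠ 0) (ζ : ℂ) : ζ ∈ domain b R ↔
    ζ ^ 2 - (b : ℂ) ^ 2 ≠ 0 ∧ (b : ℂ) ^ 2 * ζ ^ 2 - (R : ℂ) ^ 4 ≠ 0 := by
  have hb' : (b : ℂ) ≠ 0 := by exact_mod_cast hb
  have h1 : ζ ^ 2 - (b : ℂ) ^ 2 = (ζ - b) * (ζ - -b) := by ring
  have h2 : (b : ℂ) ^ 2 * ζ ^ 2 - (R : ℂ) ^ 4 =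
      b ^ 2 * ((ζ - R ^ 2 / b) * (ζ - -(R ^ 2 / b))) := by
    field_simp
    ring
  rw [h1, h2]
  simp only [domain, mem_ofPred_eq, ne_eq, mul_eq_zero, not_or, sub_eq_zero, pow_eq_zero_iff,
    hb', not_false_eq_true, true_and, and_assoc, OfNat.ofNat_ne_zero]

theorem isOpen_domain (b R : ℝ) : IsOpen (domain b R) :=
  (isOpen_ne.inter (isOpen_ne.inter (isOpen_ne.inter isOpen_ne)))

/-- The level `E`, in polar coordinates. -/
theorem norm_eq_iff_radiusSq (hb : 0 < b) (hbR : b < R) {E r ψ : ℝ} (hE : E ∈ energies b R) :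
    ‖((r : ℂ) * Complex.exp (ψ * Complex.I)) ^ 2 - (b : ℂ) ^ 2‖ =
      E * ‖(b : ℂ) ^ 2 * ((r : ℂ) * Complex.exp (ψ * Complex.I)) ^ 2 - (R : ℂ) ^ 4‖ ↔
    r ^ 2 = radiusSq b R (Real.cos (2 * ψ)) E := by
  have hE0 := energy_pos hb hbR hE
  have hD := levelDen_pos hb hbR hE
  have h1 := sq_norm_mul_polar_sub (b ^ 2) 1 (r ^ 2) (2 * ψ)
  have h2 := sq_norm_mul_polar_sub (R ^ 4) (b ^ 2) (r ^ 2) (2 * ψ)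
  rw [← polar_sq] at h1 h2
  push_cast at h1 h2
  rw [one_mul] at h1
  have hm : levelParam b R E * (1 - E ^ 2 * b ^ 4) = 1 - E ^ 2 * R ^ 4 :=
    div_mul_cancel₀ _ hD.ne'
  set c := Real.cos (2 * ψ)
  -- The difference of the squared sides of the level equation is `1 - E²b⁴` times the quadratic in
  -- `r²`.
  have key : ∀ q : ℝ, q = (r ^ 2) ^ 2 - 2 * b ^ 2 * c * levelParam b R E * r ^ 2
      + (b ^ 4 + R ^ 4) * levelParam b R E - R ^ 4 →
      ((1 ^ 2 * (r ^ 2) ^ 2 - 2 * (1 * r ^ 2 * b ^ 2 * c) + (b ^ 2) ^ 2) - E ^ 2 *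
      ((b ^ 2) ^ 2 * (r ^ 2) ^ 2 - 2 * (b ^ 2 * r ^ 2 * R ^ 4 * c) + (R ^ 4) ^ 2)) =
      (1 - E ^ 2 * b ^ 4) * q := by
    rintro q rfl
    linear_combination (2 * b ^ 2 * c * r ^ 2 - (b ^ 4 + R ^ 4)) * hm
  have key' := key _ rfl
  rw [← sq_eq_sq₀ (norm_nonneg _) (by positivity), mul_pow E, h1, h2, ← sub_eq_zero, key',
    mul_eq_zero, or_iff_right hD.ne']
  refine ⟨eq_radiusSq_of_root hb hbR hE (sq_nonneg r), fun h => ?_⟩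
  rw [h]
  exact radiusSq_root hb hbR hE

include hb hbR

theorem level_levelPoint {p : ℝ × ℝ} (hp : p.2 ∈ energies b R) :
    ‖levelPoint b R p ^ 2 - (b : ℂ) ^ 2‖ =
      p.2 * ‖(b : ℂ) ^ 2 * levelPoint b R p ^ 2 - (R : ℂ) ^ 4‖ :=
  (norm_eq_iff_radiusSq hb hbR hp).2 (Real.sq_sqrt (radiusSq_pos hb hbR hp).le)

/-- If one of `ζ² - b²` and `b²ζ² - R⁴` vanished, the level equation would make the other vanish
too, which `b⁴ ≠ R⁴` excludes. -/
theorem levelPoint_mem_domain {p : ℝ × ℝ} (hp : p.2 ∈ energies b R) :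
    levelPoint b R p ∈ domain b R := by
  have h := level_levelPoint hb hbR hp
  have hE := energy_pos hb hbR hp
  have h4 := pow_four_lt hb hbR
  have hne : ∀ w : ℂ, w - (b : ℂ) ^ 2 = 0 → (b : ℂ) ^ 2 * w - (R : ℂ) ^ 4 = 0 → False := by
    intro w h1 h2
    have h3 : ((b ^ 4 - R ^ 4 : ℝ) : ℂ) = 0 := by
      push_cast
      linear_combination h2 - (b : ℂ) ^ 2 * h1
    rw [Complex.ofReal_eq_zero] at h3
    linarith
  rw [mem_domain_iff hb.ne']
  constructor <;> intro h0
  · rw [h0, norm_zero, eq_comm, mul_eq_zero, or_iff_right hE.ne', norm_eq_zero] at h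
    exact hne _ h0 h
  · rw [h0, norm_zero, mul_zero, norm_eq_zero] at h
    exact hne _ h h0

theorem avgHamiltonian_levelPoint (Γ : ℝ) {p : ℝ × ℝ} (hp : p.2 ∈ energies b R) :
    avgHamiltonian b R Γ (levelPoint b R p) = Γ / (4 * Real.pi) * Real.log p.2 := by
  have hd := levelPoint_mem_domain hb hbR hp
  rw [avgHamiltonian_eq_log b R Γ hb.ne' _ hd, norm_div, level_levelPoint hb hbR hp,
    mul_div_cancel_right₀]
  exact norm_ne_zero_iff.2 ((mem_domain_iff hb.ne' _).1 hd).2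

theorem levelPoint_injective_energy {p q : ℝ × ℝ} (hp : p.2 ∈ energies b R)
    (hq : q.2 ∈ energies b R) (h : levelPoint b R p = levelPoint b R q) : p.2 = q.2 := by
  have h1 := level_levelPoint hb hbR hp
  have hd := levelPoint_mem_domain hb hbR hp
  rw [h] at h1 hd
  rw [level_levelPoint hb hbR hq] at h1
  exact (mul_right_cancel₀ (norm_ne_zero_iff.2 ((mem_domain_iff hb.ne' _).1 hd).2) h1).symm

theorem levelPoint_eq_iff {p q : ℝ × ℝ} (hp : p.2 ∈ energies b R) (hq : q.2 ∈ energies b R) :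
    levelPoint b R p = levelPoint b R q ↔
      p.2 = q.2 ∧ ∃ k : ℤ, q.1 = p.1 + 2 * Real.pi * k := by
  constructor
  · intro h
    have hn : Real.sqrt (radiusSq b R (Real.cos (2 * p.1)) p.2) =
        Real.sqrt (radiusSq b R (Real.cos (2 * q.1)) q.2) := by
      rw [← norm_levelPoint, h, norm_levelPoint]
    refine ⟨levelPoint_injective_energy hb hbR hp hq h, ?_⟩
    rw [levelPoint, levelPoint, hn] at h
    have h0 : (Real.sqrt (radiusSq b R (Real.cos (2 * q.1)) q.2) : ℂ) ≠ 0 := by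
      exact_mod_cast (Real.sqrt_pos.2 (radiusSq_pos hb hbR hq)).ne'
    obtain ⟨k, hk⟩ := Complex.exp_eq_exp_iff_exists_int.1 (mul_left_cancel₀ h0 h).symm
    refine ⟨k, ?_⟩
    have h2 : (q.1 : ℂ) = ((p.1 + 2 * Real.pi * k : ℝ) : ℂ) := by
      apply mul_right_cancel₀ Complex.I_ne_zero
      rw [hk]
      push_cast
      ring
    exact_mod_cast h2
  · rintro ⟨h, k, hk⟩
    have hc : Real.cos (2 * q.1) = Real.cos (2 * p.1) := by
      rw [hk, show 2 * (p.1 + 2 * Real.pi * k) = 2 * p.1 + ((2 * k : ℤ) : ℝ) * (2 * Real.pi) by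
        push_cast; ring, Real.cos_add_int_mul_two_pi]
    rw [levelPoint, levelPoint, hc, ← h]
    congr 1
    refine Complex.exp_eq_exp_iff_exists_int.2 ⟨-k, ?_⟩
    rw [hk]
    push_cast
    ring

/-- A point of the annulus lies on a level curve. -/
theorem annulus_eq_image {Γ E₀ : ℝ} (hΓ : 0 < Γ) (hE₀ : Icc E₀ (1 / R ^ 2) ⊆ energies b R)
    (hlt : E₀ < 1 / R ^ 2) :
    annulus b R Γ E₀ = levelPoint b R '' (univ ×ˢ Icc E₀ (1 / R ^ 2)) := by
  have hR : 0 < R := hb.trans hbR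
  have hk : 0 < Γ / (4 * Real.pi) := by positivity
  have h0 : 0 < E₀ := energy_pos hb hbR (hE₀ (left_mem_Icc.2 hlt.le))
  ext ζ
  constructor
  · rintro ⟨hd, -, h1, h2⟩
    rw [avgHamiltonian_eq_log b R Γ hb.ne' ζ hd] at h1 h2
    obtain ⟨n1, n2⟩ := (mem_domain_iff hb.ne' ζ).1 hd
    set E := ‖(ζ ^ 2 - (b : ℂ) ^ 2) / ((b : ℂ) ^ 2 * ζ ^ 2 - (R : ℂ) ^ 4)‖ with hE
    have hEpos : 0 < E := norm_pos_iff.2 (div_ne_zero n1 n2)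
    have hEm : E ∈ Icc E₀ (1 / R ^ 2) :=
      ⟨(Real.log_le_log_iff h0 hEpos).1 (le_of_mul_le_mul_left h1 hk),
        (Real.log_le_log_iff hEpos (by positivity)).1 (le_of_mul_le_mul_left h2 hk)⟩
    refine ⟨(Complex.arg ζ, E), ⟨mem_univ _, hEm⟩, ?_⟩
    have hlev : ‖ζ ^ 2 - (b : ℂ) ^ 2‖ = E * ‖(b : ℂ) ^ 2 * ζ ^ 2 - (R : ℂ) ^ 4‖ := by
      rw [hE, norm_div, div_mul_cancel₀ _ (norm_ne_zero_iff.2 n2)]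
    rw [← Complex.norm_mul_exp_arg_mul_I ζ, norm_eq_iff_radiusSq hb hbR (hE₀ hEm)] at hlev
    rw [levelPoint, ← hlev, Real.sqrt_sq (norm_nonneg _)]
    exact Complex.norm_mul_exp_arg_mul_I ζ
  · rintro ⟨p, ⟨-, hp⟩, rfl⟩
    have hp' := hE₀ hp
    refine ⟨levelPoint_mem_domain hb hbR hp', ?_, ?_, ?_⟩
    · rw [norm_levelPoint]
      exact Real.sqrt_le_iff.2 ⟨hR.le, radiusSq_le hb hbR hp' hp.2 (Real.cos_le_one _)⟩
    · rw [avgHamiltonian_levelPoint hb hbR Γ hp']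
      exact mul_le_mul_of_nonneg_left (Real.log_le_log h0 hp.1) hk.le
    · rw [avgHamiltonian_levelPoint hb hbR Γ hp']
      exact mul_le_mul_of_nonneg_left (Real.log_le_log (h0.trans_le hp.1) hp.2) hk.le

theorem contDiffAt_radius {p : ℝ × ℝ} (hp : p.2 ∈ energies b R) :
    ContDiffAt ℝ ∞ (fun p : ℝ × ℝ => Real.sqrt (radiusSq b R (Real.cos (2 * p.1)) p.2)) p :=
  (contDiffAt_radiusSq hb hbR (f := fun p : ℝ × ℝ => Real.cos (2 * p.1)) (by fun_prop)
    contDiffAt_snd hp).sqrt (radiusSq_pos hb hbR hp).ne'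

theorem contDiffAt_levelPoint {p : ℝ × ℝ} (hp : p.2 ∈ energies b R) :
    ContDiffAt ℝ ∞ (levelPoint b R) p := by
  have h := Complex.ofRealCLM.contDiff.contDiffAt.comp p (contDiffAt_radius hb hbR hp)
  have h1 : ContDiff ℝ ∞ fun p : ℝ × ℝ => (p.1 : ℂ) := Complex.ofRealCLM.contDiff.comp contDiff_fst
  exact h.mul ((h1.mul contDiff_const).cexp.contDiffAt)

theorem differentiableAt_levelPoint {p : ℝ × ℝ} (hp : p.2 ∈ energies b R) :
    DifferentiableAt ℝ (levelPoint b R) p :=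
  (contDiffAt_levelPoint hb hbR hp).differentiableAt (by simp)

/-- The area form in the coordinates `(ψ, E)`. -/
theorem area_levelPoint {p : ℝ × ℝ} (hp : p.2 ∈ energies b R) :
    ((starRingEnd ℂ) (fderiv ℝ (levelPoint b R) p (0, 1)) *
      fderiv ℝ (levelPoint b R) p (1, 0)).im =
      radiusSqDeriv b R (Real.cos (2 * p.1)) p.2 / 2 := by
  obtain ⟨ψ, E⟩ := p
  have hP := (differentiableAt_levelPoint hb hbR hp).hasFDerivAt
  have hr := ((contDiffAt_radius hb hbR hp).differentiableAt (by simp)).hasFDerivAt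
  set r : ℝ := Real.sqrt (radiusSq b R (Real.cos (2 * ψ)) E) with hr0
  have hrpos : 0 < r := Real.sqrt_pos.2 (radiusSq_pos hb hbR hp)
  have h1 : HasDerivAt (fun s => levelPoint b R (s, E))
      (fderiv ℝ (levelPoint b R) (ψ, E) (1, 0)) ψ := by
    exact (HasFDerivAt.comp ψ (f := fun s : ℝ => (s, E)) hP
      (hasFDerivAt_prodMk_left ψ E)).hasDerivAt.congr_deriv (by simp)
  have h2 : HasDerivAt (fun s => levelPoint b R (ψ, s))
      (fderiv ℝ (levelPoint b R) (ψ, E) (0, 1)) E := by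
    exact (HasFDerivAt.comp E (f := fun s : ℝ => (ψ, s)) hP
      (hasFDerivAt_prodMk_right ψ E)).hasDerivAt.congr_deriv (by simp)
  -- The value of `∂r/∂ψ` is irrelevant: `∂_E ζ` is radial, so only the component `r i e^{iψ}` of
  -- `∂_ψ ζ` spans area with it, and `r ∂r/∂E` is half of `∂ρ/∂E`.
  obtain ⟨a, ha⟩ : ∃ a, HasDerivAt
      (fun s => Real.sqrt (radiusSq b R (Real.cos (2 * s)) E)) a ψ :=
    ⟨_, (HasFDerivAt.comp ψ (f := fun s : ℝ => (s, E)) hr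
      (hasFDerivAt_prodMk_left ψ E)).hasDerivAt⟩
  have he : HasDerivAt (fun s : ℝ => Complex.exp (s * Complex.I))
      (Complex.exp (ψ * Complex.I) * Complex.I) ψ := by
    simpa using ((Complex.ofRealCLM.hasDerivAt (x := ψ)).mul_const Complex.I).cexp
  have h1' := h1.unique (ha.ofReal_comp.mul he)
  have h2' := h2.unique (((hasDerivAt_radiusSq (E := E) (c := Real.cos (2 * ψ)) hb hbR hp).sqrt
    (radiusSq_pos hb hbR hp).ne').ofReal_comp.mul_const (Complex.exp (ψ * Complex.I)))
  rw [h1', h2']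
  simp only [← hr0]
  set e := Complex.exp (ψ * Complex.I) with he0
  have hn : (starRingEnd ℂ) e * e = 1 := by
    rw [← Complex.normSq_eq_conj_mul_self, Complex.normSq_eq_norm_sq, he0,
      Complex.norm_exp_ofReal_mul_I]
    simp
  rw [map_mul, Complex.conj_ofReal, show ∀ x y z : ℂ, x * (starRingEnd ℂ) e *
    (y * e + z * (e * Complex.I)) = ((starRingEnd ℂ) e * e) * (x * y + x * z * Complex.I) by
    intros; ring, hn, one_mul]
  simp only [← Complex.ofReal_mul, Complex.add_im, Complex.ofReal_im, Complex.im_ofReal_mul,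
    Complex.I_im]
  field_simp
  ring

end Geometry

/-! ### The averaged vector field. -/

theorem conj_mul_hamiltonianField_im (H : ℂ → ℝ) (ζ u : ℂ) :
    ((starRingEnd ℂ) u * hamiltonianField H ζ).im = fderiv ℝ H ζ u := by
  have hu : u = u.re • (1 : ℂ) + u.im • Complex.I := by
    simp [Complex.re_add_im]
  conv_rhs => rw [hu]
  rw [map_add, map_smul, map_smul]
  simp [hamiltonianField]

/-- `Im (conj u * v)` is the area spanned by `u` and `v`. A plane vector is determined by the areas
it spans with a basis, and zero area with `v` means that it is parallel to `v`. -/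
theorem eq_smul_of_area {u v X : ℂ} {d h : ℝ} (hd : d ≠ 0)
    (huv : ((starRingEnd ℂ) u * v).im = d) (hv : ((starRingEnd ℂ) v * X).im = 0)
    (hu : ((starRingEnd ℂ) u * X).im = h) : X = ((h / d : ℝ) : ℂ) * v := by
  simp only [Complex.mul_im, Complex.conj_re, Complex.conj_im] at huv hv hu
  apply Complex.ext
  · rw [Complex.re_ofReal_mul, div_mul_eq_mul_div, eq_div_iff hd, ← huv, ← hu]
    linear_combination (-u.re) * hv
  · rw [Complex.im_ofReal_mul, div_mul_eq_mul_div, eq_div_iff hd, ← huv, ← hu]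
    linear_combination (-u.im) * hv

theorem contDiffOn_avgHamiltonian {b R : ℝ} (hb : 0 < b) (Γ : ℝ) :
    ContDiffOn ℝ ∞ (avgHamiltonian b R Γ) (domain b R) := by
  refine ContDiffOn.congr ?_ (fun ζ hζ => avgHamiltonian_eq_log b R Γ hb.ne' ζ hζ)
  intro ζ hζ
  obtain ⟨n1, n2⟩ := (mem_domain_iff hb.ne' ζ).1 hζ
  have hq := div_ne_zero n1 n2
  have h : ContDiffAt ℝ ∞
      (fun ζ : ℂ => (ζ ^ 2 - (b : ℂ) ^ 2) / ((b : ℂ) ^ 2 * ζ ^ 2 - (R : ℂ) ^ 4)) ζ := by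
    have h1 : ContDiffAt ℝ ∞ (fun ζ : ℂ => ζ ^ 2 - (b : ℂ) ^ 2) ζ := by fun_prop
    have h2 : ContDiffAt ℝ ∞ (fun ζ : ℂ => (b : ℂ) ^ 2 * ζ ^ 2 - (R : ℂ) ^ 4) ζ := by fun_prop
    simp_rw [div_eq_mul_inv]
    exact h1.mul (h2.inv n2)
  exact (contDiffAt_const.mul ((h.norm ℝ hq).log (norm_ne_zero_iff.2 hq))).contDiffWithinAt

theorem contDiffOn_hamiltonianField {b R : ℝ} (hb : 0 < b) (Γ : ℝ) :
    ContDiffOn ℝ 1 (hamiltonianField (avgHamiltonian b R Γ)) (domain b R) := by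
  have h := (contDiffOn_avgHamiltonian hb Γ).fderiv_of_isOpen (m := 1) (isOpen_domain b R)
    (by norm_cast)
  have h1 := h.clm_apply (contDiffOn_const (c := (1 : ℂ)))
  have h2 := h.clm_apply (contDiffOn_const (c := Complex.I))
  have : hamiltonianField (avgHamiltonian b R Γ) = fun ζ =>
      Complex.equivRealProdCLM.symm (-(fderiv ℝ (avgHamiltonian b R Γ) ζ Complex.I),
        fderiv ℝ (avgHamiltonian b R Γ) ζ 1) := by
    funext ζ
    apply Complex.ext <;> simp [hamiltonianField]
  rw [this]
  exact Complex.equivRealProdCLM.symm.contDiff.comp_contDiffOn (h2.neg.prodMk h1)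

/-- The averaged vector field is tangent to the level curves. -/
theorem hamiltonianField_levelPoint {b R : ℝ} (hb : 0 < b) (hbR : b < R) (Γ : ℝ) {p : ℝ × ℝ}
    (hp : p.2 ∈ energies b R) :
    hamiltonianField (avgHamiltonian b R Γ) (levelPoint b R p) =
      ((Γ / (4 * Real.pi) * p.2⁻¹ / (radiusSqDeriv b R (Real.cos (2 * p.1)) p.2 / 2) : ℝ) : ℂ) *
        fderiv ℝ (levelPoint b R) p (1, 0) := by
  have hH : DifferentiableAt ℝ (avgHamiltonian b R Γ) (levelPoint b R p) :=
    ((contDiffOn_avgHamiltonian hb Γ).contDiffAt ((isOpen_domain b R).mem_nhds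
      (levelPoint_mem_domain hb hbR hp))).differentiableAt (by simp)
  have hc := hH.hasFDerivAt.comp p (differentiableAt_levelPoint hb hbR hp).hasFDerivAt
  have hl : HasFDerivAt (avgHamiltonian b R Γ ∘ levelPoint b R)
      ((Γ / (4 * Real.pi)) • (p.2⁻¹ • ContinuousLinearMap.snd ℝ ℝ ℝ)) p := by
    refine (((hasFDerivAt_snd (𝕜 := ℝ) (p := p)).log
      (energy_pos hb hbR hp).ne').const_mul (Γ / (4 * Real.pi))).congr_of_eventuallyEq ?_
    filter_upwards [continuousAt_snd.preimage_mem_nhds ((isOpen_energies b R).mem_nhds hp)]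
      with q hq using avgHamiltonian_levelPoint hb hbR Γ hq
  have he := hc.unique hl
  have hpos := radiusSqDeriv_pos (c := Real.cos (2 * p.1)) hb hbR hp (Real.cos_le_one _)
  -- The areas spanned with the Hamiltonian field are directional derivatives of the energy `(Γ/4π)
  -- ln E`: zero along `∂_ψ`, and `Γ/(4πE)` along `∂_E`.
  refine eq_smul_of_area (by positivity) (area_levelPoint hb hbR hp) ?_ ?_
  · rw [conj_mul_hamiltonianField_im]
    simpa using DFunLike.congr_fun he (1, 0)
  · rw [conj_mul_hamiltonianField_im]
    simpa using DFunLike.congr_fun he (0, 1)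

/-! ### The angle variable and the action-angle coordinates. -/

/-- The derivative with respect to the energy of the area of the sector of polar angles
`[0, ψ]`, as a function of `(ψ, E)`. -/
def sectorDeriv (b R : ℝ) (p : ℝ × ℝ) : ℝ :=
  1 / 2 * ∫ s in (0 : ℝ)..p.1, radiusSqDeriv b R (Real.cos (2 * s)) p.2

/-- The angle variable as a function of the polar angle and the energy. -/
def angle (b R : ℝ) (p : ℝ × ℝ) : ℝ := sectorDeriv b R p / actionDeriv b R p.2

/-- The derivative of the angle variable with respect to the polar angle. -/
def angleDeriv (b R : ℝ) (p : ℝ × ℝ) : ℝ :=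
  radiusSqDeriv b R (Real.cos (2 * p.1)) p.2 / 2 / actionDeriv b R p.2

/-- The angle and action variables as functions of the polar angle and the energy. -/
def angleAction (b R : ℝ) (p : ℝ × ℝ) : ℝ × ℝ := (angle b R p, action b R p.2)

/-- The polar angle and the energy as functions of the angle and action variables. -/
def angleActionInv (b R : ℝ) : ℝ × ℝ → ℝ × ℝ :=
  Function.invFunOn (angleAction b R) (univ ×ˢ energies b R)

/-- The point with angle `θ` and action `J`. -/
def angleActionPoint (b R θ J : ℝ) : ℂ := levelPoint b R (angleActionInv b R (θ, J))

theorem isOpen_univ_prod_energies (b R : ℝ) : IsOpen ((univ : Set ℝ) ×ˢ energies b R) :=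
  isOpen_univ.prod (isOpen_energies b R)

/-- The linear automorphism with matrix `(α, β; 0, γ)`. -/
def upperTriangularEquiv (α β γ : ℝ) (hα : α ≠ 0) (hγ : γ ≠ 0) : (ℝ × ℝ) ≃L[ℝ] ℝ × ℝ :=
  ContinuousLinearEquiv.equivOfInverse
    ((α • ContinuousLinearMap.fst ℝ ℝ ℝ + β • ContinuousLinearMap.snd ℝ ℝ ℝ).prod
      (γ • ContinuousLinearMap.snd ℝ ℝ ℝ))
    ((α⁻¹ • ContinuousLinearMap.fst ℝ ℝ ℝ - (β / (γ * α)) • ContinuousLinearMap.snd ℝ ℝ ℝ).prod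
      (γ⁻¹ • ContinuousLinearMap.snd ℝ ℝ ℝ))
    (by
      rintro ⟨x, y⟩
      ext
      · simp only [ContinuousLinearMap.prod_apply, sub_apply,
          add_apply, smul_apply,
          ContinuousLinearMap.coe_fst', ContinuousLinearMap.coe_snd', smul_eq_mul]
        field_simp
        ring
      · simp [hγ])
    (by
      rintro ⟨x, y⟩
      ext
      · simp only [ContinuousLinearMap.prod_apply, sub_apply,
          add_apply, smul_apply,
          ContinuousLinearMap.coe_fst', ContinuousLinearMap.coe_snd', smul_eq_mul]
        field_simp
        ring
      · simp [hγ])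

section Angle

variable {b R : ℝ} (hb : 0 < b) (hbR : b < R)
include hb hbR

theorem continuous_radiusSqDeriv_angle {E : ℝ} (hE : E ∈ energies b R) :
    Continuous fun s => radiusSqDeriv b R (Real.cos (2 * s)) E :=
  continuous_iff_continuousAt.2 fun s => (contDiffAt_radiusSqDeriv hb hbR
    (f := fun s : ℝ => Real.cos (2 * s)) (g := fun _ => E) (by fun_prop) contDiffAt_const
      hE).continuousAt

/-- The substitution `s = ψ t` moves the variable upper limit into the integrand, leaving an
integral over `[0, 1]` with parameters. -/
theorem contDiffOn_sectorDeriv :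
    ContDiffOn ℝ ∞ (sectorDeriv b R) (univ ×ˢ energies b R) := by
  have h : ContDiffOn ℝ ∞ (fun q : (ℝ × ℝ) × ℝ =>
      radiusSqDeriv b R (Real.cos (2 * (q.1.1 * q.2))) q.1.2)
      ((univ ×ˢ energies b R) ×ˢ univ) := fun q hq =>
    (contDiffAt_radiusSqDeriv hb hbR
      (f := fun q : (ℝ × ℝ) × ℝ => Real.cos (2 * (q.1.1 * q.2))) (g := fun q => q.1.2)
      (by fun_prop) (by fun_prop) hq.1.2).contDiffWithinAt
  have h1 := contDiffOn_intervalIntegral_param (isOpen_univ_prod_energies b R) h 0 1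
  refine ((contDiffOn_const (c := (1 / 2 : ℝ))).mul (contDiffOn_fst.mul h1)).congr fun p _ => ?_
  have := intervalIntegral.smul_integral_comp_mul_left
    (fun s => radiusSqDeriv b R (Real.cos (2 * s)) p.2) (a := 0) (b := 1) p.1
  rw [mul_zero, mul_one, smul_eq_mul] at this
  rw [sectorDeriv, ← this]

theorem contDiffAt_angle {p : ℝ × ℝ} (hp : p.2 ∈ energies b R) :
    ContDiffAt ℝ ∞ (angle b R) p :=
  ((contDiffOn_sectorDeriv hb hbR).contDiffAt
    ((isOpen_univ_prod_energies b R).mem_nhds ⟨mem_univ _, hp⟩)).div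
    ((contDiffAt_actionDeriv hb hbR hp).comp p contDiffAt_snd) (actionDeriv_pos hb hbR hp).ne'

theorem contDiffAt_angleAction {p : ℝ × ℝ} (hp : p.2 ∈ energies b R) :
    ContDiffAt ℝ ∞ (angleAction b R) p :=
  (contDiffAt_angle hb hbR hp).prodMk ((contDiffAt_action hb hbR hp).comp p contDiffAt_snd)

theorem angleDeriv_pos {p : ℝ × ℝ} (hp : p.2 ∈ energies b R) : 0 < angleDeriv b R p :=
  div_pos (half_pos (radiusSqDeriv_pos hb hbR hp (Real.cos_le_one _))) (actionDeriv_pos hb hbR hp)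

theorem hasDerivAt_angle {E : ℝ} (hE : E ∈ energies b R) (ψ : ℝ) :
    HasDerivAt (fun s => angle b R (s, E)) (angleDeriv b R (ψ, E)) ψ := by
  have hc := continuous_radiusSqDeriv_angle hb hbR hE
  have h := ((hc.integral_hasStrictDerivAt 0 ψ).hasDerivAt.const_mul (1 / 2)).div_const
    (actionDeriv b R E)
  refine h.congr_deriv ?_
  rw [angleDeriv]
  ring

theorem strictMono_angle {E : ℝ} (hE : E ∈ energies b R) :
    StrictMono fun s => angle b R (s, E) :=
  strictMono_of_deriv_pos fun ψ => by
    rw [(hasDerivAt_angle hb hbR hE ψ).deriv]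
    exact angleDeriv_pos hb hbR (p := (ψ, E)) hE

/-- The cosine term integrates to zero over a period, and the symmetry `s ↦ π - s` doubles the
quarter-turn integral defining `I'`. -/
theorem integral_radiusSqDeriv {E : ℝ} (hE : E ∈ energies b R) :
    ∫ s in (0 : ℝ)..Real.pi, radiusSqDeriv b R (Real.cos (2 * s)) E =
      2 * Real.pi * actionDeriv b R E := by
  have hc := continuous_levelWidthDeriv_angle hb hbR hE
  have h1 : ∫ s in (0 : ℝ)..Real.pi, Real.cos (2 * s) = 0 := by
    rw [intervalIntegral.integral_comp_mul_left _ (two_ne_zero), integral_cos]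
    simp
  have h2 : ∫ s in (Real.pi / 2)..Real.pi, levelWidthDeriv b R (Real.cos (2 * s)) E =
      ∫ s in (0 : ℝ)..(Real.pi / 2), levelWidthDeriv b R (Real.cos (2 * s)) E := by
    have := intervalIntegral.integral_comp_sub_left
      (fun s => levelWidthDeriv b R (Real.cos (2 * s)) E) (a := Real.pi / 2) (b := Real.pi) Real.pi
    rw [sub_self, sub_half] at this
    rw [← this]
    refine intervalIntegral.integral_congr fun s _ => ?_
    simp only [mul_sub, Real.cos_two_pi_sub]
  have h3 := intervalIntegral.integral_add_adjacent_intervals (μ := volume)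
    (hc.intervalIntegrable 0 (Real.pi / 2)) (hc.intervalIntegrable (Real.pi / 2) Real.pi)
  have h4 : ∀ s : ℝ, radiusSqDeriv b R (Real.cos (2 * s)) E =
      b ^ 2 * levelParamDeriv b R E * Real.cos (2 * s) +
        levelWidthDeriv b R (Real.cos (2 * s)) E := by
    intro s
    rw [radiusSqDeriv]
    ring
  simp_rw [h4]
  rw [intervalIntegral.integral_add (Continuous.intervalIntegrable (by fun_prop) _ _)
    (hc.intervalIntegrable _ _), intervalIntegral.integral_const_mul, h1, ← h3, h2, actionDeriv]
  field_simp
  ring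

/-- The integrand has period `π`, and `k` turns are `2k` periods; division by `I'(E)` normalises the
gain per turn to `2π`. -/
theorem angle_add {E : ℝ} (hE : E ∈ energies b R) (ψ : ℝ) (k : ℤ) :
    angle b R (ψ + 2 * Real.pi * k, E) = angle b R (ψ, E) + 2 * Real.pi * k := by
  have hc := continuous_radiusSqDeriv_angle hb hbR hE
  have hA := (actionDeriv_pos hb hbR hE).ne'
  have hper : Function.Periodic (fun s => radiusSqDeriv b R (Real.cos (2 * s)) E) Real.pi := by
    intro s
    simp only [mul_add, Real.cos_add_two_pi]
  have h1 := hper.intervalIntegral_add_zsmul_eq (2 * k) ψ fun _ _ => hc.intervalIntegrable _ _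
  rw [hper.intervalIntegral_add_eq ψ 0, zero_add, integral_radiusSqDeriv hb hbR hE] at h1
  have h2 : ψ + (2 * k) • Real.pi = ψ + 2 * Real.pi * k := by
    simp only [zsmul_eq_mul]
    push_cast
    ring
  rw [h2] at h1
  have h3 := intervalIntegral.integral_add_adjacent_intervals (μ := volume)
    (hc.intervalIntegrable 0 ψ) (hc.intervalIntegrable ψ (ψ + 2 * Real.pi * k))
  simp only [angle, sectorDeriv]
  rw [← h3, h1, zsmul_eq_mul]
  push_cast
  field_simp

/-- The angle is continuous in `ψ` and fixes every multiple of `2π`, so it takes every value in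
between. -/
theorem surjective_angle {E : ℝ} (hE : E ∈ energies b R) :
    Function.Surjective fun s => angle b R (s, E) := by
  intro θ
  have hc : Continuous fun s => angle b R (s, E) :=
    continuous_iff_continuousAt.2 fun ψ => (hasDerivAt_angle hb hbR hE ψ).continuousAt
  have h0 : ∀ k : ℤ, angle b R (2 * Real.pi * k, E) = 2 * Real.pi * k := by
    intro k
    have h := angle_add hb hbR hE 0 k
    rwa [zero_add, show angle b R (0, E) = 0 by simp [angle, sectorDeriv], zero_add] at h
  have hpi := Real.two_pi_pos
  refine mem_range_of_exists_le_of_exists_ge hc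
    ⟨2 * Real.pi * (⌊θ / (2 * Real.pi)⌋ : ℤ), ?_⟩ ⟨2 * Real.pi * (⌈θ / (2 * Real.pi)⌉ : ℤ), ?_⟩
  · rw [h0, mul_comm]
    exact (le_div_iff₀ hpi).1 (Int.floor_le _)
  · rw [h0, mul_comm]
    exact (div_le_iff₀ hpi).1 (Int.le_ceil _)

theorem leftInvOn_angleActionInv :
    LeftInvOn (angleActionInv b R) (angleAction b R) (univ ×ˢ energies b R) := by
  refine InjOn.leftInvOn_invFunOn ?_
  rintro ⟨ψ, E⟩ ⟨-, hE⟩ ⟨ψ', E'⟩ ⟨-, hE'⟩ h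
  obtain ⟨h1, h2⟩ := Prod.mk_inj.1 h
  obtain rfl := (strictMonoOn_action hb hbR).injOn hE hE' h2
  rw [(strictMono_angle hb hbR hE).injective h1]

theorem angleActionPoint_angleAction {p : ℝ × ℝ} (hp : p.2 ∈ energies b R) :
    angleActionPoint b R (angle b R p) (action b R p.2) = levelPoint b R p :=
  congrArg (levelPoint b R) (leftInvOn_angleActionInv hb hbR ⟨mem_univ _, hp⟩)

theorem exists_angle_eq (θ : ℝ) {E : ℝ} (hE : E ∈ energies b R) :
    ∃ ψ, angle b R (ψ, E) = θ := surjective_angle hb hbR hE θ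

/-- The action does not depend on `ψ`, so the differential is triangular and invertible as soon as
`∂θ/∂ψ` and `I'` are nonzero. -/
theorem hasFDerivAt_angleAction {p : ℝ × ℝ} (hp : p.2 ∈ energies b R) :
    HasFDerivAt (angleAction b R) ((upperTriangularEquiv (angleDeriv b R p)
      (fderiv ℝ (angle b R) p (0, 1)) (actionDeriv b R p.2) (angleDeriv_pos hb hbR hp).ne'
      (actionDeriv_pos hb hbR hp).ne' : (ℝ × ℝ) ≃L[ℝ] ℝ × ℝ) : ℝ × ℝ →L[ℝ] ℝ × ℝ) p := by
  have h1 := ((contDiffAt_angle hb hbR hp).differentiableAt (by simp)).hasFDerivAt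
  have h2 := (hasDerivAt_action hb hbR hp).comp_hasFDerivAt p
    (hasFDerivAt_snd (𝕜 := ℝ) (p := p))
  have h3 : fderiv ℝ (angle b R) p (1, 0) = angleDeriv b R p := by
    have := (HasFDerivAt.comp p.1 (f := fun s : ℝ => (s, p.2)) h1
      (hasFDerivAt_prodMk_left p.1 p.2)).hasDerivAt.unique (hasDerivAt_angle hb hbR hp p.1)
    simpa using this
  refine (h1.prodMk h2).congr_fderiv ?_
  ext <;> simp [upperTriangularEquiv, h3]

theorem contDiffAt_angleActionInv {p : ℝ × ℝ} (hp : p.2 ∈ energies b R) :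
    ContDiffAt ℝ ∞ (angleActionInv b R) (angleAction b R p) :=
  contDiffAt_of_leftInvOn (leftInvOn_angleActionInv hb hbR) (isOpen_univ_prod_energies b R)
    ⟨mem_univ _, hp⟩ (contDiffAt_angleAction hb hbR hp) (hasFDerivAt_angleAction hb hbR hp)

theorem contDiffAt_angleActionPoint {p : ℝ × ℝ} (hp : p.2 ∈ energies b R) :
    ContDiffAt ℝ ∞ (fun q : ℝ × ℝ => angleActionPoint b R q.1 q.2) (angleAction b R p) := by
  refine ContDiffAt.comp (g := levelPoint b R) _ ?_ (contDiffAt_angleActionInv hb hbR hp)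
  rw [leftInvOn_angleActionInv hb hbR ⟨mem_univ _, hp⟩]
  exact contDiffAt_levelPoint hb hbR hp

theorem hasFDerivAt_angleActionPoint {p : ℝ × ℝ} (hp : p.2 ∈ energies b R) :
    HasFDerivAt (fun q : ℝ × ℝ => angleActionPoint b R q.1 q.2)
      ((fderiv ℝ (levelPoint b R) p).comp ((upperTriangularEquiv (angleDeriv b R p)
      (fderiv ℝ (angle b R) p (0, 1)) (actionDeriv b R p.2) (angleDeriv_pos hb hbR hp).ne'
      (actionDeriv_pos hb hbR hp).ne').symm : ℝ × ℝ →L[ℝ] ℝ × ℝ)) (angleAction b R p) := by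
  have h := hasFDerivAt_of_leftInvOn (leftInvOn_angleActionInv hb hbR)
    (isOpen_univ_prod_energies b R) ⟨mem_univ _, hp⟩ (hasFDerivAt_angleAction hb hbR hp)
    ((contDiffAt_angleActionInv hb hbR hp).differentiableAt (by simp))
  refine HasFDerivAt.comp (g := levelPoint b R) _ ?_ h
  rw [leftInvOn_angleActionInv hb hbR ⟨mem_univ _, hp⟩]
  exact (differentiableAt_levelPoint hb hbR hp).hasFDerivAt

theorem hasDerivAt_angleActionPoint_angle {p : ℝ × ℝ} (hp : p.2 ∈ energies b R) :
    HasDerivAt (fun θ => angleActionPoint b R θ (action b R p.2))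
      ((angleDeriv b R p)⁻¹ • fderiv ℝ (levelPoint b R) p (1, 0)) (angle b R p) := by
  refine (HasFDerivAt.comp (angle b R p) (f := fun s : ℝ => (s, action b R p.2))
    (hasFDerivAt_angleActionPoint hb hbR hp)
    (hasFDerivAt_prodMk_left _ _)).hasDerivAt.congr_deriv ?_
  rw [← map_smul]
  simp [upperTriangularEquiv]

/-- The second summand reflects the dependence of the angle on `E`. It is parallel to the derivative
in `θ` and spans no area with it, so `∂θ/∂E` need not be computed. -/
theorem hasDerivAt_angleActionPoint_action {p : ℝ × ℝ} (hp : p.2 ∈ energies b R) :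
    HasDerivAt (fun J => angleActionPoint b R (angle b R p) J)
      ((actionDeriv b R p.2)⁻¹ • fderiv ℝ (levelPoint b R) p (0, 1) -
        (fderiv ℝ (angle b R) p (0, 1) / (actionDeriv b R p.2 * angleDeriv b R p)) •
          fderiv ℝ (levelPoint b R) p (1, 0)) (action b R p.2) := by
  refine (HasFDerivAt.comp (action b R p.2) (f := fun s : ℝ => (angle b R p, s))
    (hasFDerivAt_angleActionPoint hb hbR hp)
    (hasFDerivAt_prodMk_right _ _)).hasDerivAt.congr_deriv ?_
  rw [← map_smul, ← map_smul, ← map_sub]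
  simp [upperTriangularEquiv]

theorem angleActionPoint_eq_iff {θ θ' E E' : ℝ} (hE : E ∈ energies b R)
    (hE' : E' ∈ energies b R) :
    angleActionPoint b R θ (action b R E) = angleActionPoint b R θ' (action b R E') ↔
      action b R E = action b R E' ∧ ∃ k : ℤ, θ' = θ + 2 * Real.pi * k := by
  obtain ⟨ψ, rfl⟩ := exists_angle_eq hb hbR θ hE
  obtain ⟨ψ', rfl⟩ := exists_angle_eq hb hbR θ' hE'
  rw [angleActionPoint_angleAction hb hbR (p := (ψ, E)) hE,
    angleActionPoint_angleAction hb hbR (p := (ψ', E')) hE', levelPoint_eq_iff hb hbR hE hE',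
    (strictMonoOn_action hb hbR).injOn.eq_iff hE hE']
  refine and_congr_right fun h => ?_
  obtain rfl : E = E' := h
  simp_rw [← angle_add hb hbR hE]
  exact exists_congr fun k => ((strictMono_angle hb hbR hE).injective.eq_iff
    (a := ψ') (b := ψ + 2 * Real.pi * k)).symm

/-- The averaged motion in action-angle variables. -/
theorem isAvgTrajectory_angleActionPoint (Γ T θ : ℝ) {E : ℝ} (hE : E ∈ energies b R) :
    IsAvgTrajectory b R Γ T
      fun t => angleActionPoint b R (θ + T * frequency b R Γ E * t) (action b R E) := by
  intro t _
  obtain ⟨ψ, hψ⟩ := exists_angle_eq hb hbR (θ + T * frequency b R Γ E * t) hE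
  have hpt := angleActionPoint_angleAction hb hbR (p := (ψ, E)) hE
  have hd := hasDerivAt_angleActionPoint_angle hb hbR (p := (ψ, E)) hE
  have hl : HasDerivAt (fun t => θ + T * frequency b R Γ E * t) (T * frequency b R Γ E) t := by
    simpa using ((hasDerivAt_id t).const_mul (T * frequency b R Γ E)).const_add θ
  rw [hψ] at hpt hd
  dsimp only at hpt ⊢
  refine ⟨?_, ?_⟩
  · rw [hpt]
    exact levelPoint_mem_domain hb hbR (p := (ψ, E)) hE
  · refine (hd.scomp t hl).hasDerivWithinAt.congr_deriv ?_
    rw [hpt, hamiltonianField_levelPoint hb hbR Γ (p := (ψ, E)) hE, smul_smul,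
      Complex.real_smul, ← mul_assoc, ← Complex.ofReal_mul]
    -- The velocity `(Γ/4πE)/(ρ_E/2)` of the polar angle times `∂θ/∂ψ = (ρ_E/2)/I'` is the frequency
    -- `Γ/(4πE I')`.
    congr 2
    have h1 := (actionDeriv_pos hb hbR hE).ne'
    have h2 := (radiusSqDeriv_pos (c := Real.cos (2 * ψ)) hb hbR hE (Real.cos_le_one _)).ne'
    have h3 := (energy_pos hb hbR hE).ne'
    simp only [frequency, angleDeriv]
    field_simp

end Angle

/-! ### Action-angle coordinates on the annulus and the Poincaré map. -/

section Main

variable {b R E₀ : ℝ} (hb : 0 < b) (hbR : b < R)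
  (hE₀ : E₀ ∈ Ioo (sInf (twistEnergies b R)) (1 / R ^ 2))
include hb hbR hE₀

theorem isActionAngle_angleActionPoint {Γ : ℝ} (hΓ : 0 < Γ) :
    IsActionAngle (avgHamiltonian b R Γ) (annulus b R Γ E₀) (action b R E₀) (R ^ 2 / 2)
      (energyOfAction b R Γ E₀) (angleActionPoint b R) := by
  have hsub := Icc_subset_energies hb hbR hE₀
  have hbij := bijOn_action hb hbR hE₀
  have hpar : ∀ θ : ℝ, ∀ J ∈ Icc (action b R E₀) (R ^ 2 / 2), ∃ p : ℝ × ℝ,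
      p.2 ∈ Icc E₀ (1 / R ^ 2) ∧ angle b R p = θ ∧ action b R p.2 = J := by
    intro θ J hJ
    obtain ⟨E, hE, rfl⟩ := hbij.surjOn hJ
    obtain ⟨ψ, hψ⟩ := exists_angle_eq hb hbR θ (hsub hE)
    exact ⟨(ψ, E), hE, hψ, rfl⟩
  refine ⟨?_, ?_, ?_, ?_, ?_⟩
  · rintro ⟨θ, J⟩ ⟨-, hJ⟩
    obtain ⟨p, hp, rfl, rfl⟩ := hpar θ J hJ
    exact (contDiffAt_angleActionPoint hb hbR (hsub hp)).contDiffWithinAt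
  · rw [annulus_eq_image hb hbR hΓ hsub hE₀.2]
    ext ζ
    constructor
    · rintro ⟨⟨θ, J⟩, ⟨-, hJ⟩, rfl⟩
      obtain ⟨p, hp, rfl, rfl⟩ := hpar θ J hJ
      exact ⟨p, ⟨mem_univ _, hp⟩, (angleActionPoint_angleAction hb hbR (hsub hp)).symm⟩
    · rintro ⟨p, ⟨-, hp⟩, rfl⟩
      exact ⟨angleAction b R p, ⟨mem_univ _, hbij.mapsTo hp⟩,
        angleActionPoint_angleAction hb hbR (hsub hp)⟩
  · intro θ θ' J hJ J' hJ'
    obtain ⟨E, hE, rfl⟩ := hbij.surjOn hJ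
    obtain ⟨E', hE', rfl⟩ := hbij.surjOn hJ'
    exact angleActionPoint_eq_iff hb hbR (hsub hE) (hsub hE')
  · intro θ J hJ
    have hu := uniqueDiffOn_Icc (action_lt_half hb hbR hE₀) J hJ
    obtain ⟨p, hp, rfl, rfl⟩ := hpar θ J hJ
    have hp' := hsub hp
    rw [(hasDerivAt_angleActionPoint_angle hb hbR hp').deriv,
      (hasDerivAt_angleActionPoint_action hb hbR hp').hasDerivWithinAt.derivWithin hu]
    have harea := area_levelPoint hb hbR hp'
    have h1 := (actionDeriv_pos hb hbR hp').ne'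
    have h2 := (radiusSqDeriv_pos (c := Real.cos (2 * p.1)) hb hbR hp' (Real.cos_le_one _)).ne'
    set u := fderiv ℝ (levelPoint b R) p (0, 1)
    set v := fderiv ℝ (levelPoint b R) p (1, 0)
    -- The area form is bilinear and alternating, so the `v` component of the action derivative
    -- disappears.
    have key : ∀ x y z : ℝ, ((starRingEnd ℂ) (x • u - y • v) * (z • v)).im =
        x * z * ((starRingEnd ℂ) u * v).im := by
      intro x y z
      simp only [Complex.mul_im, Complex.conj_re, Complex.conj_im, Complex.sub_re,
        Complex.sub_im, Complex.real_smul, Complex.mul_re, Complex.ofReal_re, Complex.ofReal_im]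
      ring
    rw [key, harea, angleDeriv]
    field_simp
  · intro θ J hJ
    obtain ⟨p, hp, rfl, rfl⟩ := hpar θ J hJ
    rw [angleActionPoint_angleAction hb hbR (hsub hp), energyOfAction_eqOn hb hbR hE₀ Γ hJ,
      avgHamiltonian_levelPoint hb hbR Γ (hsub hp), extEnergy, energyInv_action hb hbR (hsub hp)]

theorem exists_poincareMap {Γ : ℝ} (hΓ : 0 < Γ) (T : ℝ) : ∃ M : ℂ → ℂ,
    IsAvgPoincareMap b R Γ T (annulus b R Γ E₀) M ∧
    ∀ θ : ℝ, ∀ J ∈ Icc (action b R E₀) (R ^ 2 / 2), M (angleActionPoint b R θ J) =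
      angleActionPoint b R (θ + T * derivWithin (energyOfAction b R Γ E₀)
        (Icc (action b R E₀) (R ^ 2 / 2)) J) J := by
  have hsub := Icc_subset_energies hb hbR hE₀
  have hbij := bijOn_action hb hbR hE₀
  have haa := isActionAngle_angleActionPoint hb hbR hE₀ hΓ
  have hex : ∀ ζ ∈ annulus b R Γ E₀, ∃ η, IsAvgTrajectory b R Γ T η ∧ η 0 = ζ := by
    intro ζ hζ
    rw [← haa.image_eq] at hζ
    obtain ⟨⟨θ, J⟩, ⟨-, hJ⟩, rfl⟩ := hζ
    obtain ⟨E, hE, rfl⟩ := hbij.surjOn hJ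
    exact ⟨_, isAvgTrajectory_angleActionPoint hb hbR Γ T θ (hsub hE), by simp⟩
  have huniq : ∀ η₁ η₂, IsAvgTrajectory b R Γ T η₁ → IsAvgTrajectory b R Γ T η₂ →
      η₁ 0 = η₂ 0 → η₁ 1 = η₂ 1 := fun η₁ η₂ h₁ h₂ h0 =>
    ode_unique_of_contDiffOn (isOpen_domain b R)
      (contDiffOn_const.mul (contDiffOn_hamiltonianField hb Γ)) h₁ h₂ h0
      (right_mem_Icc.2 zero_le_one)
  -- The map sends each point to the end of a chosen trajectory; uniqueness makes the choice
  -- immaterial and allows evaluation along the explicit rotation.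
  choose! η hη hη0 using hex
  have hM : IsAvgPoincareMap b R Γ T (annulus b R Γ E₀) fun ζ => η ζ 1 := fun ζ hζ =>
    ⟨⟨η ζ, hη ζ hζ, hη0 ζ hζ⟩, fun η' h' h0 =>
      huniq η' (η ζ) h' (hη ζ hζ) (h0.trans (hη0 ζ hζ).symm)⟩
  refine ⟨_, hM, fun θ J hJ => ?_⟩
  have hζ : angleActionPoint b R θ J ∈ annulus b R Γ E₀ := by
    rw [← haa.image_eq]
    exact ⟨(θ, J), ⟨mem_univ _, hJ⟩, rfl⟩
  rw [derivWithin_energyOfAction hb hbR hE₀ Γ hJ]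
  obtain ⟨E, hE, rfl⟩ := hbij.surjOn hJ
  have := (hM _ hζ).2 _ (isAvgTrajectory_angleActionPoint hb hbR Γ T θ (hsub hE)) (by simp)
  rw [mul_one] at this
  rw [energyInv_action hb hbR (hsub hE)]
  exact this.symm

end Main

end Stirring

end

theorem mainTheorem2 (b R Γ : ℝ) (hb : 0 < b) (hbR : b < R) (hΓ : 0 < Γ) :
    (∀ E ∈ Set.Ioc (b ^ 2 / R ^ 4) (1 / R ^ 2), ContDiffAt ℝ ∞ (Stirring.action b R) E) ∧
    1 / R ^ 2 ∈ Stirring.regularEnergies b R ∧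
    (∃ Es ∈ Set.Ico (b ^ 2 / R ^ 4) (1 / R ^ 2),
      Stirring.twistEnergies b R = Set.Ioc Es (1 / R ^ 2)) ∧
    ∀ E₀ ∈ Set.Ioo (sInf (Stirring.twistEnergies b R)) (1 / R ^ 2),
      Set.BijOn (Stirring.action b R) (Set.Icc E₀ (1 / R ^ 2))
        (Set.Icc (Stirring.action b R E₀) (R ^ 2 / 2)) ∧
      ContDiffOn ℝ ∞ (Stirring.energyOfAction b R Γ E₀)
        (Set.Icc (Stirring.action b R E₀) (R ^ 2 / 2)) ∧
      (∀ J ∈ Set.Icc (Stirring.action b R E₀) (R ^ 2 / 2),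
        iteratedDerivWithin 2 (Stirring.energyOfAction b R Γ E₀)
          (Set.Icc (Stirring.action b R E₀) (R ^ 2 / 2)) J < 0) ∧
      ∃ Φ : ℝ → ℝ → ℂ,
        Stirring.IsActionAngle (Stirring.avgHamiltonian b R Γ) (Stirring.annulus b R Γ E₀)
          (Stirring.action b R E₀) (R ^ 2 / 2) (Stirring.energyOfAction b R Γ E₀) Φ ∧
        ∀ T : ℝ, 0 < T → ∃ M : ℂ → ℂ,
          Stirring.IsAvgPoincareMap b R Γ T (Stirring.annulus b R Γ E₀) M ∧
          Stirring.IsSmallTwistMap T (Stirring.action b R E₀) (R ^ 2 / 2)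
            (derivWithin (Stirring.energyOfAction b R Γ E₀)
              (Set.Icc (Stirring.action b R E₀) (R ^ 2 / 2))) Φ M := by
  refine ⟨fun E hE => Stirring.contDiffAt_action hb hbR (Stirring.Ioc_subset_energies hb hbR hE),
    Stirring.boundary_mem_regularEnergies hb hbR, Stirring.exists_twistEnergies_eq hb hbR,
    fun E₀ hE₀ => ?_⟩
  have hlt := Stirring.action_lt_half hb hbR hE₀
  have hsmooth := Stirring.contDiffOn_energyOfAction hb hbR hE₀ Γ
  refine ⟨Stirring.bijOn_action hb hbR hE₀, hsmooth,
    fun J hJ => Stirring.iteratedDerivWithin_energyOfAction_neg hb hbR hE₀ hΓ hJ,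
    Stirring.angleActionPoint b R, Stirring.isActionAngle_angleActionPoint hb hbR hE₀ hΓ,
    fun T _ => ?_⟩
  obtain ⟨M, hM, hmap⟩ := Stirring.exists_poincareMap hb hbR hE₀ hΓ T
  exact ⟨M, hM, Stirring.action_pos hb hbR (Stirring.Icc_subset_energies hb hbR hE₀
      (Set.left_mem_Icc.2 hE₀.2.le)), hlt,
    hsmooth.derivWithin (uniqueDiffOn_Icc hlt) (by simp),
    fun J hJ => (Stirring.derivWithin_derivWithin_energyOfAction_neg hb hbR hE₀ hΓ hJ).ne, hmap⟩
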